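/- Let $p$ be an odd prime and write $x_{(a,k)}=p^k(ap-(a+1))$ for $a\ge 1$, $k\ge 0$. Let $\lambda(c;(n,i))$ denote the hook partition $(n-i,1^i)$ placed on floor $c$; adding a block $B(m,n)$ adds $m$ nodes to its first row and $n$ nodes to its first column. **The $p$-Bratteli diagram.** Its floors are $1,2,3,\dots$. For $r\ge 1$, the vertices of floor $2r-1$ are $\lambda(2r-1;(p^{r-1}(p-1),i))$ with $0\le i<p^{r-1}(p-1)$, and $\lambda(2r-1;(x_{(2(r-k)-1,k)},x_{(r-k-1,k)}+l'))$ with $0\le k\le r-2$, $0\le l'<p^{k+1}$. The vertices of floor $2r$ are $\lambda(2r;(p^{r-1}(p-1),i))$ with $0\le i<p^{r-1}(p-1)$, and $\lambda(2r;(x_{(2(r-k),k)},x_{(r-k,k)}+l))$ with $0\le k\le r-1$, $0\le l<p^k$. The edges from floor $c$ to floor $c+1$, each labelled by the block (called the $c$-th block) that is added, are the following. * $\lambda(2r-1;(p^{r-1}(p-1),i))\to\lambda(2r;(p^{r-1}(p-1),i))$, block $B(0,0)$, for $r\ge1$, $0\le i<p^{r-1}(p-1)$. * $\lambda(2r-1;(p^{r-1}(p-1),i))\to\lambda(2r;(x_{(2,r-1)},i+p^{r-1}(p-2-t)))$,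 block $B(p^{r-1}t,\,p^{r-1}(p-2-t))$, for $r\ge1$, $0\le t\le p-2$, $p^{r-1}t\le i<p^{r-1}(t+1)$. * $\lambda(2r-2;(p^{r-2}(p-1),i))\to\lambda(2r-1;(p^{r-1}(p-1),pi+t))$, block $B(p^{r-2}(p-1)^2-(i(p-1)+t),\,i(p-1)+t)$, for $r\ge2$, $0\le i<p^{r-2}(p-1)$, $0\le t\le p-1$. * For $k\ge0$, $s=r-k\ge2$, $0\le l<p^k$, $0\le t\le p-1$: $\lambda(2r-2;(x_{(2(s-1),k)},x_{(s-1,k)}+l))\to\lambda(2r-1;(x_{(2s-1,k)},x_{(s-1,k)}+pl+t))$, block $B(p^k(p-1)-((p-1)l+t),\,(p-1)l+t)$. * For $k\ge0$, $s=r-k\ge2$, $0\le l<p^k$, $0\le t\le p-1$: $\lambda(2r-1;(x_{(2s-1,k)},x_{(s-1,k)}+l+p^kt))\to\lambda(2r;(x_{(2s,k)},x_{(s,k)}+l))$, block $B(p^kt,\,p^k(p-1-t))$. **Descents.** Let $k\ge 0$, $s\ge1$, $r=k+s$, $0\le l<p^k$, and let $P$ be a path (one vertex on each floor, consecutive ones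 joined by an edge) from some vertex of floor $1$ to $\lambda(2r;(x_{(2s,k)},x_{(s,k)}+l))$, with blocks $B(m_i,n_i)$, $1\le i\le 2r-1$. For $2k+2\le i\le 2r-2$, the path has a descent at $i$ if $m_i+n_i=m_{i+1}+n_{i+1}$, $m_i>m_{i+1}$ and $n_i<n_{i+1}$. It has a descent at $i=2k$ if $(m_{2k+1},n_{2k+1})=(p^kt,p^k(p-2-t))$ for some $0\le t<\frac{p-1}{2}$. There are no other descents. The $p^{(k)}$-Fibonacci number $\mathcal M=\mathcal M\big(\lambda(2r;(x_{(2s,k)},x_{(s,k)}+l))\big)$ is the total number of descents of all such paths $P$ ending at this vertex. **Theorem.** Let $k\ge 2$, $3\le s<k+2$, $r=k+s$ and $0\le l<p^k$. Put $\sigma_a^b=\sum_{j=a}^{b}p^j$ (zero if $a>b$). Then: **(a)** If $l=0$, then $\mathcal M=\frac{p-1}{2}\big(2(s-1)p^{s-1}+1\big)$. **(b)** For $1\le t\le\frac{p-3}{2}$: (i) if $0\le i\le s-4$ and $(t-1)\sigma_i^{k-1}+p^i\le l\le (t-1)\sigma_{i+1}^{k-1}+p^{i+1}-1$, then $\mathcal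 M=\frac{p-1}{2}\big(2(s-1)p^{s-1}+1+2t\,\sigma_0^{s-3}-2\sigma_0^{s-i-4}\big)$; (ii) if $(t-1)\sigma_{s-3}^{k-1}+p^{s-3}\le l\le t\,\sigma_0^{k-1}$, then $\mathcal M=\frac{p-1}{2}\big(2(s-1)p^{s-1}+1+2t\,\sigma_0^{s-3}\big)$. **(c)** (i) If $0\le i\le s-4$ and $\frac{p-3}{2}\sigma_i^{k-1}+p^i\le l\le \frac{p-3}{2}\sigma_{i+1}^{k-1}+p^{i+1}-1$, then $\mathcal M=\frac{p-1}{2}\big(2(s-1)p^{s-1}+1+(p-1)\sigma_0^{s-3}-2\sigma_0^{s-i-4}\big)$; (ii) if $\frac{p-3}{2}\sigma_{s-3}^{k-1}+p^{s-3}\le l\le \frac{p-1}{2}\sigma_{s-2}^{k-1}-1$, then $\mathcal M=\frac{p-1}{2}\big(2(s-1)p^{s-1}+1+p^{s-2}-1\big)$; (iii) if $1\le i'\le s-2$ and $\frac{p-1}{2}\sigma_{i'}^{k-1}\le l\le\frac{p-1}{2}\sigma_{i'-1}^{k-1}-1$, then $\mathcal M=\frac{p-1}{2}\big(2(s-1)p^{s-1}-1-p^{s-2}-2\sigma_1^{s-3}+2\sigma_{s-i'-1}^{s-2}-1\big)$;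 (iv) if $l=\frac{p-1}{2}\sigma_0^{k-1}$, then $\mathcal M=\frac{p-1}{2}\big(2(s-1)p^{s-1}-1-p^{s-2}-2\sigma_1^{s-3}-1\big)$. **(d)** For $\frac{p+1}{2}\le t\le p-1$: (i) if $0\le i\le s-4$ and $(t-1)\sigma_i^{k-1}+p^i\le l\le (t-1)\sigma_{i+1}^{k-1}+p^{i+1}-1$, then $\mathcal M=\frac{p-1}{2}\big(2(s-1)p^{s-1}-1+(2t-2p)\sigma_0^{s-3}-2\sigma_0^{s-i-4}\big)$; (ii) if $(t-1)\sigma_{s-3}^{k-1}+p^{s-3}\le l\le t\,\sigma_0^{k-1}$, then $\mathcal M=\frac{p-1}{2}\big(2(s-1)p^{s-1}-1+(2t-2p)\sigma_0^{s-3}\big)$. -/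

import Mathlib

namespace PBratteli

/-- The hook partition `(n - i, 1^i)` of `n`, with `size = n` and `leg = i`: it has `n - i` nodes in
its first row and `i` further nodes in its first column. -/
@[ext]
structure Hook where
  size : ℕ
  leg : ℕ

/-- A block of nodes added to a hook partition: `horiz` nodes in the first row and `vert` nodes
in the first column. -/
@[ext]
structure Block where
  horiz : ℕ
  vert : ℕ

/-- `x_{(a,k)} = p^k (a p - (a + 1))`. It is used for `a ≥ 1` and `p ≥ 3` only, where the
subtraction does not truncate. -/
def hookX (p a k : ℕ) : ℕ := p ^ k * (a * p - (a + 1))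

/-- The hook `(p^j (p-1), i)`; for `i < p^j (p-1)` these form the first family of vertices of the
floors `2j+1` and `2j+2`. -/
def rowVertex (p j i : ℕ) : Hook := ⟨p ^ j * (p - 1), i⟩

/-- The hook `(x_{(2s,k)}, x_{(s,k)} + l)`: the vertex in position `l` of the `k`-th family of the
floor `2r`, where `s = r - k ≥ 1`. -/
def evenVertex (p k s l : ℕ) : Hook := ⟨hookX p (2 * s) k, hookX p s k + l⟩

/-- The hook `(x_{(2s-1,k)}, x_{(s-1,k)} + l')`: the vertex in position `l'` of the `k`-th family of
the floor `2r-1`, where `s = r - k ≥ 2`. -/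
def oddVertex (p k s l' : ℕ) : Hook := ⟨hookX p (2 * s - 1) k, hookX p (s - 1) k + l'⟩

/-- `v` is a vertex of the `c`-th floor (`c ≥ 1`) of the `p`-Bratteli diagram. -/
inductive IsVertex (p : ℕ) : ℕ → Hook → Prop
  /-- first family of the floor `2r-1`, with `r = j + 1` -/
  | oddRow (j i : ℕ) (hi : i < p ^ j * (p - 1)) : IsVertex p (2 * j + 1) (rowVertex p j i)
  /-- `k`-th family of the floor `2r-1`, with `r = k + s` and `s ≥ 2` -/
  | odd (k s l' : ℕ) (hs : 2 ≤ s) (hl : l' < p ^ (k + 1)) :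
      IsVertex p (2 * (k + s) - 1) (oddVertex p k s l')
  /-- first family of the floor `2r`, with `r = j + 1` -/
  | evenRow (j i : ℕ) (hi : i < p ^ j * (p - 1)) : IsVertex p (2 * j + 2) (rowVertex p j i)
  /-- `k`-th family of the floor `2r`, with `r = k + s` and `s ≥ 1` -/
  | even (k s l : ℕ) (hs : 1 ≤ s) (hl : l < p ^ k) :
      IsVertex p (2 * (k + s)) (evenVertex p k s l)

/-- `Edge p c u B v`: in the `p`-Bratteli diagram there is an edge from the vertex `u` of the
`c`-th floor to the vertex `v` of the `(c+1)`-st floor, obtained by adding the `c`-th block `B`. -/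
inductive Edge (p : ℕ) : ℕ → Hook → Block → Hook → Prop
  /-- the empty block, from the floor `2j+1` to the floor `2j+2` -/
  | empty (j i : ℕ) (hi : i < p ^ j * (p - 1)) :
      Edge p (2 * j + 1) (rowVertex p j i) ⟨0, 0⟩ (rowVertex p j i)
  /-- from the first family of the floor `2j+1` to the `j`-th family of the floor `2j+2` -/
  | turn (j i t : ℕ) (ht : t ≤ p - 2) (hi : p ^ j * t ≤ i) (hi' : i < p ^ j * (t + 1)) :
      Edge p (2 * j + 1) (rowVertex p j i) ⟨p ^ j * t, p ^ j * (p - 2 - t)⟩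
        ⟨hookX p 2 j, i + p ^ j * (p - 2 - t)⟩
  /-- from the first family of the floor `2j+2` to the first family of the floor `2j+3` -/
  | row (j i t : ℕ) (hi : i < p ^ j * (p - 1)) (ht : t ≤ p - 1) :
      Edge p (2 * j + 2) (rowVertex p j i)
        ⟨p ^ j * (p - 1) ^ 2 - (i * (p - 1) + t), i * (p - 1) + t⟩
        (rowVertex p (j + 1) (p * i + t))
  /-- within the `k`-th family, from the floor `2r-2` to the floor `2r-1`, with `r = k + s` -/
  | up (k s l t : ℕ) (hs : 2 ≤ s) (hl : l < p ^ k) (ht : t ≤ p - 1) :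
      Edge p (2 * (k + s) - 2) (evenVertex p k (s - 1) l)
        ⟨p ^ k * (p - 1) - ((p - 1) * l + t), (p - 1) * l + t⟩
        (oddVertex p k s (p * l + t))
  /-- within the `k`-th family, from the floor `2r-1` to the floor `2r`, with `r = k + s` -/
  | down (k s l t : ℕ) (hs : 2 ≤ s) (hl : l < p ^ k) (ht : t ≤ p - 1) :
      Edge p (2 * (k + s) - 1) (oddVertex p k s (l + p ^ k * t))
        ⟨p ^ k * t, p ^ k * (p - 1 - t)⟩
        (evenVertex p k s l)

/-- The vertex on the `c`-th floor (`1 ≤ c ≤ n`) of a sequence of `n` hooks, one for each of the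
floors `1, …, n`. -/
def vertexAt {n : ℕ} (P : Fin n → Hook) (c : ℕ) : Hook :=
  if h : c - 1 < n then P ⟨c - 1, h⟩ else ⟨0, 0⟩

/-- The `c`-th block of the sequence: the nodes added between the floors `c` and `c + 1`. -/
def blockAt {n : ℕ} (P : Fin n → Hook) (c : ℕ) : Block where
  horiz := ((vertexAt P (c + 1)).size - (vertexAt P (c + 1)).leg)
    - ((vertexAt P c).size - (vertexAt P c).leg)
  vert := (vertexAt P (c + 1)).leg - (vertexAt P c).leg

/-- The sequence of hooks is a path of the `p`-Bratteli diagram from the first floor to the vertex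
`v` of the floor `n`. -/
structure IsPathTo (p : ℕ) {n : ℕ} (v : Hook) (P : Fin n → Hook) : Prop where
  isVertex : ∀ c, 1 ≤ c → c ≤ n → IsVertex p c (vertexAt P c)
  edge : ∀ c, 1 ≤ c → c < n → Edge p c (vertexAt P c) (blockAt P c) (vertexAt P (c + 1))
  last : vertexAt P n = v

/-- `B > B'` for two blocks of the same size. -/
def Block.Gt (B B' : Block) : Prop :=
  B.horiz + B.vert = B'.horiz + B'.vert ∧ B'.horiz < B.horiz ∧ B.vert < B'.vert

open Classical in
/-- The descent set of a path `P` ending on the floor `2r` in a vertex of the `k`-th family.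
For `2k+2 ≤ i ≤ 2r-2`, there is a descent at `i` if the `i`-th block is greater than the `(i+1)`-st.
There is a descent at `2k` if the `(2k+1)`-st block is `(p^k t, p^k (p-2-t))` with
`0 ≤ t < (p-1)/2`. There are no other descents. -/
noncomputable def descentSet (p k : ℕ) {r : ℕ} (P : Fin (2 * r) → Hook) : Finset ℕ :=
  (Finset.range (2 * r - 1)).filter fun i =>
    (2 * k + 2 ≤ i ∧ (blockAt P i).Gt (blockAt P (i + 1))) ∨
    (i = 2 * k ∧ ∃ t < (p - 1) / 2, blockAt P (2 * k + 1) = ⟨p ^ k * t, p ^ k * (p - 2 - t)⟩)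

/-- The `p^(k)`-Fibonacci number at the vertex `v` of the `k`-th family of the floor `2r`: the total
number of descents of all paths of the `p`-Bratteli diagram from the first floor to `v`. -/
noncomputable def fibonacciNumber (p k r : ℕ) (v : Hook) : ℕ :=
  ∑ᶠ P ∈ {P : Fin (2 * r) → Hook | IsPathTo p v P}, (descentSet p k P).card

/-- Every floor has finitely many vertices. -/
theorem finite_isVertex (p c : ℕ) : {v | IsVertex p c v}.Finite := by
  let R : Finset ℕ := Finset.range (c + 1)
  have h1 : (⋃ j ∈ R, rowVertex p j '' (Finset.range (p ^ j * (p - 1)) : Set ℕ)).Finite :=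
    R.finite_toSet.biUnion fun _ _ => (Finset.finite_toSet _).image _
  have h2 : (⋃ k ∈ R, ⋃ s ∈ R, oddVertex p k s '' (Finset.range (p ^ (k + 1)) : Set ℕ)).Finite :=
    R.finite_toSet.biUnion fun _ _ => R.finite_toSet.biUnion fun _ _ =>
      (Finset.finite_toSet _).image _
  have h3 : (⋃ k ∈ R, ⋃ s ∈ R, evenVertex p k s '' (Finset.range (p ^ k) : Set ℕ)).Finite :=
    R.finite_toSet.biUnion fun _ _ => R.finite_toSet.biUnion fun _ _ =>
      (Finset.finite_toSet _).image _
  refine ((h1.union h2).union h3).subset ?_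
  rintro v (⟨j, i, hi⟩ | ⟨k, s, l, hs, hl⟩ | ⟨j, i, hi⟩ | ⟨k, s, l, hs, hl⟩)
  · refine Or.inl (Or.inl ?_)
    simp only [Set.mem_iUnion]
    exact ⟨j, Finset.mem_range.2 (by omega), i, by simpa using hi, rfl⟩
  · refine Or.inl (Or.inr ?_)
    simp only [Set.mem_iUnion]
    exact ⟨k, Finset.mem_range.2 (by omega), s, Finset.mem_range.2 (by omega), l,
      by simpa using hl, rfl⟩
  · refine Or.inl (Or.inl ?_)
    simp only [Set.mem_iUnion]
    exact ⟨j, Finset.mem_range.2 (by omega), i, by simpa using hi, rfl⟩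
  · refine Or.inr ?_
    simp only [Set.mem_iUnion]
    exact ⟨k, Finset.mem_range.2 (by omega), s, Finset.mem_range.2 (by omega), l,
      by simpa using hl, rfl⟩

/-- There are finitely many paths to a given vertex, so `fibonacciNumber` is a finite sum. -/
theorem finite_isPathTo (p n : ℕ) (v : Hook) :
    {P : Fin n → Hook | IsPathTo p v P}.Finite := by
  refine (Set.Finite.pi' fun c : Fin n => finite_isVertex p (c + 1)).subset ?_
  intro P hP c
  have h := hP.isVertex (c + 1) (by omega) (by omega)
  simpa [vertexAt] using h

/-- `∑_{ι=a}^{b} p^ι` (zero if `a > b`). -/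
def powSum (p a b : ℕ) : ℕ := ∑ j ∈ Finset.Icc a b, p ^ j

end PBratteli

open PBratteli

namespace PBratteli

/-! Write `p = 2h + 1` and follow paths backwards. Two floors below position `l` of the `k`-th
family lie the positions `(l + p^k t) / p` with `t < p`: on the `k` base-`p` digits of `l`, the last
digit is dropped and `t` is put in front. The first family contributes one path per vertex, so the
number of paths to a vertex depends on `s` but not on `l`.

Prolonging a path by two floors creates at most two descents. With `m = l + p^k t`, the two new
blocks have vertical parts `m - m / p` and `p^k (p-1-t)`. Comparing them amounts to comparing `t`
with `h`; comparing the first with the preceding block amounts to comparing `t` with an earlier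
digit. A tie is settled by comparing `l` with a constant string of digits. The resulting counts are
`h + alpha` and, summed over `t`, `p h + beta`, which gives the recursion
`fibonacciNumber_add_three`.

Summing `alpha` or `beta` over the inserted digit `t` yields the same statistic on one leading digit
fewer, plus a constant (`sum_alpha`, `sum_beta`). Hence the recursion solves to `fibonacciNumber_eq`
as long as every index `n` stays below `k`, which is what `s < k + 2` provides. The values of `l` at
which `alpha` and `beta` jump are monotone in `n`, so on each interval of the theorem both are, up
to a constant, indicators of initial segments of `n`, and the formula becomes a geometric sum. -/

/-! ### Sizes of hooks separate the families on a floor. -/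

theorem hookX_cast {p a : ℕ} (k : ℕ) (hp : 3 ≤ p) (ha : 1 ≤ a) :
    (hookX p a k : ℤ) = (p : ℤ) ^ k * (a * (p - 1) - 1) := by
  have : a + 1 ≤ a * p := by nlinarith
  unfold hookX
  push_cast [Nat.cast_sub this]
  ring

theorem hookX_one (q t k : ℕ) :
    hookX (q + t + 2) 1 k = (q + t + 2) ^ k * q + (q + t + 2) ^ k * t := by
  rw [hookX, show 1 * (q + t + 2) - (1 + 1) = q + t by omega, mul_add]

/-- On a fixed floor `a + 2k` is constant, so raising `k` by one lowers `a` by two; the extra factor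
`p` outweighs this. -/
theorem hookX_add_two_lt {p a : ℕ} (k : ℕ) (hp : 3 ≤ p) (ha : 2 ≤ a) :
    hookX p (a + 2) k < hookX p a (k + 1) := by
  zify
  rw [hookX_cast k hp (by omega), hookX_cast (k + 1) hp (by omega), pow_succ, mul_assoc]
  have h1 : (0 : ℤ) < (p : ℤ) ^ k := by positivity
  refine mul_lt_mul_of_pos_left ?_ h1
  push_cast
  have hp' : (3 : ℤ) ≤ p := by exact_mod_cast hp
  have ha' : (2 : ℤ) ≤ a := by exact_mod_cast ha
  have h2 : (0 : ℤ) < a * (p - 1) - 3 := by nlinarith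
  nlinarith

theorem hookX_add_lt {p a : ℕ} (k d : ℕ) (hp : 3 ≤ p) (ha : 2 ≤ a) :
    hookX p (a + 2 * (d + 1)) k < hookX p a (k + (d + 1)) := by
  induction d generalizing a with
  | zero => exact hookX_add_two_lt k hp ha
  | succ d ih =>
    have h1 := ih (a := a + 2) (by omega)
    have h2 := hookX_add_two_lt (k + (d + 1)) hp ha
    rw [show a + 2 * (d + 1 + 1) = a + 2 + 2 * (d + 1) by ring]
    exact h1.trans h2

/-- On a given floor, the families are told apart by the size of their hooks. -/
theorem hookX_inj {p a a' k k' : ℕ} (hp : 3 ≤ p) (ha : 2 ≤ a) (ha' : 2 ≤ a')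
    (hf : a + 2 * k = a' + 2 * k') (h : hookX p a k = hookX p a' k') : k = k' := by
  rcases lt_trichotomy k k' with hk | hk | hk
  · obtain ⟨d, rfl⟩ := Nat.exists_eq_add_of_lt hk
    have := hookX_add_lt k d hp ha'
    rw [show a = a' + 2 * (d + 1) by omega] at h
    exact absurd h this.ne
  · exact hk
  · obtain ⟨d, rfl⟩ := Nat.exists_eq_add_of_lt hk
    have := hookX_add_lt k' d hp ha
    rw [show a' = a + 2 * (d + 1) by omega] at h
    exact absurd h.symm this.ne

/-- Modulo `p - 1` the left side is `-1` and the right side is `0`. -/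
theorem hookX_ne_row {p a k j : ℕ} (hp : 3 ≤ p) (ha : 1 ≤ a) :
    hookX p a k ≠ p ^ j * (p - 1) := by
  intro h
  zify [show 1 ≤ p by omega] at h
  rw [hookX_cast k hp ha] at h
  have h1 : ((p : ℤ) - 1) ∣ p ^ k - 1 := by simpa using sub_dvd_pow_sub_pow (p : ℤ) 1 k
  obtain ⟨c, hc⟩ := h1
  have h2 : ((p : ℤ) - 1) ∣ 1 := by
    refine ⟨p ^ k * a - p ^ j - c, ?_⟩
    linear_combination -hc - h
  have := Int.le_of_dvd one_pos h2
  omega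

/-! ### Blocks as differences of hooks. -/

/-- The block that is added when the hook `u` grows to the hook `v`. -/
def Hook.blockTo (u v : Hook) : Block where
  horiz := (v.size - v.leg) - (u.size - u.leg)
  vert := v.leg - u.leg

/-- A path records hooks only, and `blockAt` recovers blocks by truncated subtraction; this lemma
and its companions check that the labels of the edges are recovered. Substituting for `p` and
expanding into monomials leaves linear arithmetic. -/
theorem blockTo_turn {p k l t : ℕ} (hp : 3 ≤ p) (hl : l < p ^ k) (ht : t ≤ p - 2) :
    (rowVertex p k (l + p ^ k * t)).blockTo (evenVertex p k 1 l) =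
      ⟨p ^ k * t, p ^ k * (p - 2 - t)⟩ := by
  obtain ⟨q, rfl⟩ : ∃ q, p = q + t + 2 := ⟨p - 2 - t, by omega⟩
  generalize hX : (q + t + 2) ^ k = X at *
  have e1 : hookX (q + t + 2) 2 k = X * q + X * t + X * (q + t + 1) := by
    rw [hookX, hX, show 2 * (q + t + 2) - (2 + 1) = q + t + (q + t + 1) by omega]; ring
  have e2 : hookX (q + t + 2) 1 k = X * q + X * t := by
    rw [hookX_one, hX]
  have e3 : X * (q + t + 2 - 1) = X * q + X * t + X := by
    rw [show q + t + 2 - 1 = q + t + 1 by omega]; ring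
  have e4 : X * (q + t + 1) = X * q + X * t + X := by ring
  have e5 : q + t + 2 - 2 - t = q := by omega
  simp only [Hook.blockTo, rowVertex, evenVertex, Block.mk.injEq, hX, mul_one, e1, e2, e3, e4, e5]
  constructor <;> omega

theorem blockTo_up {p k s l t : ℕ} (hp : 3 ≤ p) (hs : 1 ≤ s) (hl : l < p ^ k) (ht : t ≤ p - 1) :
    (evenVertex p k s l).blockTo (oddVertex p k (s + 1) (p * l + t)) =
      ⟨p ^ k * (p - 1) - ((p - 1) * l + t), (p - 1) * l + t⟩ := by
  obtain ⟨q, rfl⟩ : ∃ q, p = q + 1 := ⟨p - 1, by omega⟩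
  have h1 := hookX_cast k hp hs
  have h2 := hookX_cast k hp (a := 2 * s) (by omega)
  have h3 := hookX_cast k hp (a := 2 * s + 1) (by omega)
  generalize hX : (q + 1) ^ k = X at *
  have hX' : ((q + 1 : ℕ) : ℤ) ^ k = X := by exact_mod_cast hX
  rw [hX'] at h1 h2 h3
  have e1 : hookX (q + 1) (2 * s) k = hookX (q + 1) s k + X * q * s := by
    zify; rw [h1, h2]; push_cast; ring
  have e2 : hookX (q + 1) (2 * s + 1) k = hookX (q + 1) s k + X * q * s + X * q := by
    zify; rw [h1, h3]; push_cast; ring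
  have e3 : q * l + q ≤ X * q := by nlinarith
  have e4 : X * q ≤ X * q * s := Nat.le_mul_of_pos_right _ hs
  have e5 : (q + 1) * l = q * l + l := by ring
  simp only [Hook.blockTo, oddVertex, evenVertex, Block.mk.injEq, hX, add_tsub_cancel_right,
    show 2 * (s + 1) - 1 = 2 * s + 1 by omega, e1, e2, e5] at *
  have : l ≤ q * l := by nlinarith
  constructor <;> omega

theorem blockTo_down {p k s l t : ℕ} (hp : 3 ≤ p) (hs : 1 ≤ s) (hl : l < p ^ k) (ht : t ≤ p - 1) :
    (oddVertex p k (s + 1) (l + p ^ k * t)).blockTo (evenVertex p k (s + 1) l) =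
      ⟨p ^ k * t, p ^ k * (p - 1 - t)⟩ := by
  obtain ⟨q, rfl⟩ : ∃ q, p = q + t + 1 := ⟨p - 1 - t, by omega⟩
  have h1 := hookX_cast k hp hs
  have h4 := hookX_cast k hp (a := s + 1) (by omega)
  have h2 := hookX_cast k hp (a := 2 * (s + 1)) (by omega)
  have h3 := hookX_cast k hp (a := 2 * s + 1) (by omega)
  generalize hX : (q + t + 1) ^ k = X at *
  have hX' : ((q + t + 1 : ℕ) : ℤ) ^ k = X := by exact_mod_cast hX
  rw [hX'] at h1 h2 h3 h4
  have e1 : hookX (q + t + 1) (2 * (s + 1)) k =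
      hookX (q + t + 1) s k + X * (q + t) * s + 2 * (X * q + X * t) := by
    zify; rw [h1, h2]; push_cast; ring
  have e2 : hookX (q + t + 1) (2 * s + 1) k =
      hookX (q + t + 1) s k + X * (q + t) * s + (X * q + X * t) := by
    zify; rw [h1, h3]; push_cast; ring
  have e4 : hookX (q + t + 1) (s + 1) k = hookX (q + t + 1) s k + (X * q + X * t) := by
    zify; rw [h1, h4]; push_cast; ring
  have e5 : X * 1 ≤ X * (q + t) := Nat.mul_le_mul_left _ (by omega)
  have e6 : X * (q + t) ≤ X * (q + t) * s := Nat.le_mul_of_pos_right _ hs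
  have e7 : X * (q + t) = X * q + X * t := by ring
  simp only [Hook.blockTo, oddVertex, evenVertex, Block.mk.injEq, add_tsub_cancel_right,
    show 2 * (s + 1) - 1 = 2 * s + 1 by omega, e1, e2, e4]
  constructor <;> omega

theorem blockTo_row {p j i t : ℕ} (hp : 3 ≤ p) (hi : i < p ^ j * (p - 1)) (ht : t ≤ p - 1) :
    (rowVertex p j i).blockTo (rowVertex p (j + 1) (p * i + t)) =
      ⟨p ^ j * (p - 1) ^ 2 - (i * (p - 1) + t), i * (p - 1) + t⟩ := by
  obtain ⟨q, rfl⟩ : ∃ q, p = q + 1 := ⟨p - 1, by omega⟩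
  simp only [add_tsub_cancel_right] at *
  have e1 : (q + 1) ^ (j + 1) * q = (q + 1) ^ j * q ^ 2 + (q + 1) ^ j * q := by ring
  have e2 : (q + 1) * i = i * q + i := by ring
  have e3 : i * q + q ≤ (q + 1) ^ j * q ^ 2 := by nlinarith
  simp only [Hook.blockTo, rowVertex, Block.mk.injEq, add_tsub_cancel_right, e1, e2]
  constructor <;> omega

theorem blockTo_self (u : Hook) : u.blockTo u = ⟨0, 0⟩ := by simp [Hook.blockTo]

/-! ### Predecessors of each vertex. -/

/-- The size of the target hook fixes its family and the leg its position. Backwards, this edge puts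
a digit `t` in front of `l`, and the one of `edge_to_odd` drops the last digit. -/
theorem edge_to_even {p k s l c : ℕ} {u v : Hook} {B : Block} (hp : 3 ≤ p) (hs : 1 ≤ s)
    (h : Edge p c u B v) (hc : c = 2 * (k + s) + 1) (hv : v = evenVertex p k (s + 1) l) :
    ∃ t < p, u = oddVertex p k (s + 1) (l + p ^ k * t) := by
  cases h with
  | empty j i hi =>
    exact absurd (congrArg Hook.size hv).symm (hookX_ne_row hp (by omega))
  | turn j i t ht hi hi' =>
    have := hookX_inj hp (by omega) (by omega) (by omega) (congrArg Hook.size hv)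
    omega
  | row j i t hi ht => omega
  | up k' s' l' t hs' hl ht => omega
  | down k' s' l' t hs' hl ht =>
    obtain rfl := hookX_inj hp (by omega) (by omega) (by omega) (congrArg Hook.size hv)
    obtain rfl : s' = s + 1 := by omega
    have := congrArg Hook.leg hv
    simp only [evenVertex, Nat.add_left_cancel_iff] at this
    subst this
    exact ⟨t, by omega, rfl⟩

theorem edge_to_odd {p k s m c : ℕ} {u v : Hook} {B : Block} (hp : 3 ≤ p) (hs : 1 ≤ s)
    (h : Edge p c u B v) (hc : c = 2 * (k + s)) (hv : v = oddVertex p k (s + 1) m) :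
    u = evenVertex p k s (m / p) := by
  cases h with
  | empty j i hi => omega
  | turn j i t ht hi hi' => omega
  | row j i t hi ht =>
    exact absurd (congrArg Hook.size hv).symm (hookX_ne_row hp (by omega))
  | up k' s' l' t hs' hl ht =>
    obtain rfl := hookX_inj hp (by omega) (by omega) (by omega) (congrArg Hook.size hv)
    obtain rfl : s' = s + 1 := by omega
    have := congrArg Hook.leg hv
    simp only [oddVertex, Nat.add_left_cancel_iff] at this
    subst this
    rw [Nat.mul_add_div (by omega), Nat.div_eq_of_lt (by omega)]
    rfl
  | down k' s' l' t hs' hl ht => omega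

theorem edge_to_even_one {p k l c : ℕ} {u v : Hook} {B : Block} (hp : 3 ≤ p)
    (h : Edge p c u B v) (hc : c = 2 * k + 1) (hv : v = evenVertex p k 1 l) :
    ∃ t < p - 1, u = rowVertex p k (l + p ^ k * t) := by
  cases h with
  | empty j i hi =>
    exact absurd (congrArg Hook.size hv).symm (hookX_ne_row hp (by omega))
  | turn j i t ht hi hi' =>
    obtain rfl : j = k := by omega
    refine ⟨t, by omega, ?_⟩
    have h1 := congrArg Hook.leg hv
    obtain ⟨q, rfl⟩ : ∃ q, p = q + t + 2 := ⟨p - 2 - t, by omega⟩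
    simp only [evenVertex, hookX_one, show q + t + 2 - 2 - t = q by omega] at h1
    congr 1
    omega
  | row j i t hi ht => omega
  | up k' s' l' t hs' hl ht => omega
  | down k' s' l' t hs' hl ht =>
    have := hookX_inj hp (by omega) (by omega) (by omega) (congrArg Hook.size hv)
    omega

theorem edge_to_row_even {p j i c : ℕ} {u v : Hook} {B : Block} (hp : 3 ≤ p)
    (h : Edge p c u B v) (hc : c = 2 * j + 1) (hv : v = rowVertex p j i) :
    u = rowVertex p j i := by
  cases h with
  | empty j' i' hi => exact hv
  | turn j' i' t ht hi hi' =>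
    exact absurd (congrArg Hook.size hv) (hookX_ne_row hp (by omega))
  | row j i t hi ht => omega
  | up k' s' l' t hs' hl ht => omega
  | down k' s' l' t hs' hl ht =>
    exact absurd (congrArg Hook.size hv) (hookX_ne_row hp (by omega))

theorem edge_to_row_odd {p j i c : ℕ} {u v : Hook} {B : Block} (hp : 3 ≤ p)
    (h : Edge p c u B v) (hc : c = 2 * j + 2) (hv : v = rowVertex p (j + 1) i) :
    u = rowVertex p j (i / p) := by
  cases h with
  | empty j' i' hi => omega
  | turn j' i' t ht hi hi' => omega
  | row j' i' t hi ht =>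
    obtain rfl : j' = j := by omega
    have := congrArg Hook.leg hv
    simp only [rowVertex] at this
    subst this
    rw [Nat.mul_add_div (by omega), Nat.div_eq_of_lt (by omega)]
    rfl
  | up k' s' l' t hs' hl ht =>
    exact absurd (congrArg Hook.size hv) (hookX_ne_row hp (by omega))
  | down k' s' l' t hs' hl ht => omega

theorem edge_even {p k s l t : ℕ} (hp : 3 ≤ p) (hs : 1 ≤ s) (hl : l < p ^ k) (ht : t < p) :
    Edge p (2 * (k + s) + 1) (oddVertex p k (s + 1) (l + p ^ k * t))
      ((oddVertex p k (s + 1) (l + p ^ k * t)).blockTo (evenVertex p k (s + 1) l))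
      (evenVertex p k (s + 1) l) := by
  rw [blockTo_down hp hs hl (by omega)]
  exact Edge.down k (s + 1) l t (by omega) hl (by omega)

theorem edge_odd {p k s m : ℕ} (hp : 3 ≤ p) (hs : 1 ≤ s) (hm : m < p ^ (k + 1)) :
    Edge p (2 * (k + s)) (evenVertex p k s (m / p))
      ((evenVertex p k s (m / p)).blockTo (oddVertex p k (s + 1) m))
      (oddVertex p k (s + 1) m) := by
  have h1 : m / p < p ^ k := Nat.div_lt_of_lt_mul (by rwa [← pow_succ'])
  have h2 : m % p < p := Nat.mod_lt _ (by omega)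
  have h3 := Edge.up (p := p) k (s + 1) (m / p) (m % p) (by omega) h1 (by omega)
  have h4 := blockTo_up hp hs h1 (t := m % p) (by omega)
  rw [← h4, Nat.div_add_mod] at h3
  exact h3

theorem edge_even_one {p k l t : ℕ} (hp : 3 ≤ p) (hl : l < p ^ k) (ht : t < p - 1) :
    Edge p (2 * k + 1) (rowVertex p k (l + p ^ k * t))
      ((rowVertex p k (l + p ^ k * t)).blockTo (evenVertex p k 1 l)) (evenVertex p k 1 l) := by
  rw [blockTo_turn hp hl (by omega)]
  have := Edge.turn (p := p) k (l + p ^ k * t) t (by omega) (by omega) (by rw [mul_add]; omega)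
  convert this using 1
  obtain ⟨q, rfl⟩ : ∃ q, p = q + t + 2 := ⟨p - 2 - t, by omega⟩
  simp only [evenVertex, hookX_one, show q + t + 2 - 2 - t = q by omega, Hook.mk.injEq, mul_one,
    true_and]
  omega

theorem edge_row_odd {p j i : ℕ} (hp : 3 ≤ p) (hi : i < p ^ (j + 1) * (p - 1)) :
    Edge p (2 * j + 2) (rowVertex p j (i / p))
      ((rowVertex p j (i / p)).blockTo (rowVertex p (j + 1) i)) (rowVertex p (j + 1) i) := by
  have h1 : i / p < p ^ j * (p - 1) := Nat.div_lt_of_lt_mul (by rwa [← mul_assoc, ← pow_succ'])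
  have h2 : i % p < p := Nat.mod_lt _ (by omega)
  have h3 := Edge.row (p := p) j (i / p) (i % p) h1 (by omega)
  rw [← blockTo_row hp h1 (by omega), Nat.div_add_mod] at h3
  exact h3

/-! ### Prolonging and counting paths. -/

/-- A sequence of hooks, prolonged by one hook on the next floor. -/
def extend {n : ℕ} (P : Fin n → Hook) (v : Hook) : Fin (n + 1) → Hook :=
  Fin.snoc (α := fun _ => Hook) P v

theorem vertexAt_extend_of_le {n c : ℕ} (P : Fin n → Hook) (v : Hook) (hn : 1 ≤ n) (hc : c ≤ n) :
    vertexAt (extend P v) c = vertexAt P c := by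
  have h1 : c - 1 < n := by omega
  simp [vertexAt, extend, Fin.snoc, h1, show c - 1 < n + 1 by omega]

theorem vertexAt_extend_last {n : ℕ} (P : Fin n → Hook) (v : Hook) :
    vertexAt (extend P v) (n + 1) = v := by
  simp [vertexAt, extend, Fin.snoc]

theorem extend_init {n : ℕ} (P : Fin (n + 1) → Hook) :
    extend (fun i => P i.castSucc) (vertexAt P (n + 1)) = P := by
  have : vertexAt P (n + 1) = P (Fin.last n) := by simp [vertexAt, Fin.last]
  rw [this]
  exact Fin.snoc_init_self (α := fun _ => Hook) P

theorem extend_injective {n : ℕ} (v : Hook) :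
    Function.Injective fun P : Fin n → Hook => extend P v :=
  Fin.snoc_left_injective (α := fun _ => Hook) v

theorem blockAt_eq_blockTo {n : ℕ} (P : Fin n → Hook) (c : ℕ) :
    blockAt P c = (vertexAt P c).blockTo (vertexAt P (c + 1)) := rfl

theorem blockAt_extend_of_lt {n c : ℕ} (P : Fin n → Hook) (v : Hook) (hc : c < n) :
    blockAt (extend P v) c = blockAt P c := by
  rw [blockAt_eq_blockTo, blockAt_eq_blockTo, vertexAt_extend_of_le P v (by omega) hc.le,
    vertexAt_extend_of_le P v (by omega) hc]

theorem blockAt_extend_last {n : ℕ} (P : Fin n → Hook) (v : Hook) (hn : 1 ≤ n) :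
    blockAt (extend P v) n = (vertexAt P n).blockTo v := by
  rw [blockAt_eq_blockTo, vertexAt_extend_of_le P v hn le_rfl, vertexAt_extend_last]

theorem isPathTo_extend {p n : ℕ} {v w : Hook} {P : Fin n → Hook} (hn : 1 ≤ n) :
    IsPathTo p w (extend P v) ↔ v = w ∧ IsVertex p (n + 1) v ∧ IsPathTo p (vertexAt P n) P ∧
      Edge p n (vertexAt P n) ((vertexAt P n).blockTo v) v := by
  constructor
  · intro h
    have h1 := h.last
    rw [vertexAt_extend_last] at h1
    refine ⟨h1, ?_, ⟨fun c h1 h2 => ?_, fun c h1 h2 => ?_, rfl⟩, ?_⟩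
    · simpa [vertexAt_extend_last] using h.isVertex (n + 1) (by omega) le_rfl
    · simpa [vertexAt_extend_of_le P v hn h2] using h.isVertex c h1 (by omega)
    · have := h.edge c h1 (by omega)
      rwa [vertexAt_extend_of_le P v hn h2.le, vertexAt_extend_of_le P v hn h2,
        blockAt_extend_of_lt P v h2] at this
    · have := h.edge n hn (by omega)
      rwa [vertexAt_extend_of_le P v hn le_rfl, vertexAt_extend_last,
        blockAt_extend_last P v hn] at this
  · rintro ⟨rfl, h1, h2, h3⟩
    refine ⟨fun c hc hc' => ?_, fun c hc hc' => ?_, vertexAt_extend_last P v⟩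
    · rcases Nat.lt_or_ge n c with h | h
      · obtain rfl : c = n + 1 := by omega
        rwa [vertexAt_extend_last]
      · rw [vertexAt_extend_of_le P v hn h]
        exact h2.isVertex c hc h
    · rcases Nat.lt_or_ge c n with h | h
      · rw [vertexAt_extend_of_le P v hn h.le, vertexAt_extend_of_le P v hn h,
          blockAt_extend_of_lt P v h]
        exact h2.edge c hc h
      · obtain rfl : c = n := by omega
        rwa [vertexAt_extend_of_le P v hn le_rfl, vertexAt_extend_last,
          blockAt_extend_last P v hn]

/-- The paths from the first floor to the vertex `v` of the floor `n`. -/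
noncomputable def paths (p n : ℕ) (v : Hook) : Finset (Fin n → Hook) :=
  (finite_isPathTo p n v).toFinset

theorem mem_paths {p n : ℕ} {v : Hook} {P : Fin n → Hook} :
    P ∈ paths p n v ↔ IsPathTo p v P := by
  simp [paths]

theorem fibonacciNumber_eq_sum (p k r : ℕ) (v : Hook) :
    fibonacciNumber p k r v = ∑ P ∈ paths p (2 * r) v, (descentSet p k P).card :=
  finsum_mem_eq_finite_toFinset_sum _ _

/-- Paths to `v` split according to their last vertex but one; injectivity of `f` on `I` makes the
pieces disjoint. -/
theorem sum_paths_succ {ι : Type*} {p n : ℕ} {v : Hook} {I : Finset ι} {f : ι → Hook}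
    (hn : 1 ≤ n) (hv : IsVertex p (n + 1) v) (hf : Set.InjOn f I)
    (hI : ∀ u, Edge p n u (u.blockTo v) v ↔ ∃ t ∈ I, u = f t) (g : (Fin (n + 1) → Hook) → ℕ) :
    ∑ P ∈ paths p (n + 1) v, g P = ∑ t ∈ I, ∑ P ∈ paths p n (f t), g (extend P v) := by
  classical
  have key : paths p (n + 1) v =
      I.biUnion fun t => (paths p n (f t)).image fun P => extend P v := by
    ext P
    simp only [Finset.mem_biUnion, Finset.mem_image, mem_paths]
    constructor
    · intro h
      rw [← extend_init P, isPathTo_extend hn] at h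
      obtain ⟨h1, h2, h3, h4⟩ := h
      rw [h1] at h4
      obtain ⟨t, ht, h5⟩ := (hI _).1 h4
      refine ⟨t, ht, _, h5 ▸ h3, ?_⟩
      rw [← h1, extend_init P]
    · rintro ⟨t, ht, Q, hQ, rfl⟩
      rw [isPathTo_extend hn]
      have := hQ.last
      refine ⟨rfl, hv, this ▸ hQ, (hI _).2 ⟨t, ht, this⟩⟩
  rw [key, Finset.sum_biUnion]
  · refine Finset.sum_congr rfl fun t _ => ?_
    rw [Finset.sum_image fun P _ Q _ h => extend_injective v h]
  · intro t ht t' ht' hne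
    simp only [Function.onFun]
    rw [Finset.disjoint_left]
    intro P hP hP'
    simp only [Finset.mem_image, mem_paths] at hP hP'
    obtain ⟨Q, hQ, rfl⟩ := hP
    obtain ⟨Q', hQ', h⟩ := hP'
    obtain rfl := extend_injective v h
    exact hne (hf ht ht' (hQ.last.symm.trans hQ'.last))

theorem paths_one {p : ℕ} {v : Hook} (hv : IsVertex p 1 v) : paths p 1 v = {fun _ => v} := by
  ext P
  rw [mem_paths, Finset.mem_singleton]
  constructor
  · intro h
    funext i
    have := h.last
    rw [← this, Subsingleton.elim i 0]
    rfl
  · rintro rfl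
    refine ⟨fun c h1 h2 => ?_, fun c h1 h2 => by omega, rfl⟩
    obtain rfl : c = 1 := by omega
    exact hv

/-- In the first family every vertex above the first floor has a single predecessor. -/
theorem card_paths_row {p : ℕ} (hp : 3 ≤ p) (j i : ℕ) (hi : i < p ^ j * (p - 1)) :
    (paths p (2 * j + 1) (rowVertex p j i)).card = 1 := by
  induction j generalizing i with
  | zero => rw [paths_one (IsVertex.oddRow 0 i hi), Finset.card_singleton]
  | succ j ih =>
    have h1 : i / p < p ^ j * (p - 1) :=
      Nat.div_lt_of_lt_mul (by rwa [← mul_assoc, ← pow_succ'])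
    rw [Finset.card_eq_sum_ones]
    refine (sum_paths_succ (n := 2 * j + 2) (I := Finset.univ) (f := fun _ : Unit =>
      rowVertex p j (i / p)) (by omega) (IsVertex.oddRow (j + 1) i hi) ?_ ?_ _).trans ?_
    · exact fun _ _ _ _ _ => rfl
    · refine fun u => ⟨fun h => ⟨(), Finset.mem_univ _, edge_to_row_odd hp h rfl rfl⟩, ?_⟩
      rintro ⟨-, -, rfl⟩
      exact edge_row_odd hp hi
    rw [Finset.univ_unique, Finset.sum_singleton]
    refine (sum_paths_succ (n := 2 * j + 1) (I := Finset.univ) (f := fun _ : Unit =>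
      rowVertex p j (i / p)) (by omega) (IsVertex.evenRow j _ h1) ?_ ?_ _).trans ?_
    · exact fun _ _ _ _ _ => rfl
    · refine fun u => ⟨fun h => ⟨(), Finset.mem_univ _, edge_to_row_even hp h rfl rfl⟩, ?_⟩
      rintro ⟨-, -, rfl⟩
      rw [blockTo_self]
      exact Edge.empty j _ h1
    rw [Finset.univ_unique, Finset.sum_singleton, ← Finset.card_eq_sum_ones, ih _ h1]

theorem add_pow_mul_lt {p k l t : ℕ} (hl : l < p ^ k) (ht : t < p) :
    l + p ^ k * t < p ^ (k + 1) := by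
  have : p ^ k * (t + 1) ≤ p ^ k * p := Nat.mul_le_mul_left _ ht
  rw [pow_succ]
  rw [mul_add] at this
  omega

theorem add_pow_mul_div_lt {p k l t : ℕ} (hl : l < p ^ k) (ht : t < p) :
    (l + p ^ k * t) / p < p ^ k :=
  Nat.div_lt_of_lt_mul (by rw [← pow_succ']; exact add_pow_mul_lt hl ht)

theorem sum_paths_even {p k s l : ℕ} (hp : 3 ≤ p) (hs : 1 ≤ s) (hl : l < p ^ k)
    (g : (Fin (2 * (k + s) + 1 + 1) → Hook) → ℕ) :
    ∑ P ∈ paths p (2 * (k + s) + 1 + 1) (evenVertex p k (s + 1) l), g P =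
      ∑ t ∈ Finset.range p,
        ∑ P ∈ paths p (2 * (k + s)) (evenVertex p k s ((l + p ^ k * t) / p)),
          g (extend (extend P (oddVertex p k (s + 1) (l + p ^ k * t)))
            (evenVertex p k (s + 1) l)) := by
  have h0 : 0 < p ^ k := by positivity
  rw [sum_paths_succ (n := 2 * (k + s) + 1) (I := Finset.range p)
    (f := fun t => oddVertex p k (s + 1) (l + p ^ k * t)) (by omega)
    (IsVertex.even k (s + 1) l (by omega) hl)]
  · refine Finset.sum_congr rfl fun t ht => ?_
    have h1 := add_pow_mul_lt hl (Finset.mem_range.1 ht)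
    rw [sum_paths_succ (n := 2 * (k + s)) (I := Finset.univ) (f := fun _ : Unit =>
      evenVertex p k s ((l + p ^ k * t) / p)) (by omega)
      (IsVertex.odd k (s + 1) _ (by omega) h1)]
    · rw [Finset.univ_unique, Finset.sum_singleton]
    · exact fun _ _ _ _ _ => rfl
    · refine fun u => ⟨fun h => ⟨(), Finset.mem_univ _, edge_to_odd hp hs h rfl rfl⟩, ?_⟩
      rintro ⟨-, -, rfl⟩
      exact edge_odd hp hs h1
  · intro t _ t' _ h
    have := congrArg Hook.leg h
    simp only [oddVertex, Nat.add_left_cancel_iff] at this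
    exact Nat.eq_of_mul_eq_mul_left h0 this
  · refine fun u => ⟨fun h => ?_, ?_⟩
    · obtain ⟨t, ht, h⟩ := edge_to_even hp hs h rfl rfl
      exact ⟨t, Finset.mem_range.2 ht, h⟩
    · rintro ⟨t, ht, rfl⟩
      exact edge_even hp hs hl (Finset.mem_range.1 ht)

theorem sum_paths_even_one {p k l : ℕ} (hp : 3 ≤ p) (hl : l < p ^ k)
    (g : (Fin (2 * k + 1 + 1) → Hook) → ℕ) :
    ∑ P ∈ paths p (2 * k + 1 + 1) (evenVertex p k 1 l), g P =
      ∑ t ∈ Finset.range (p - 1), ∑ P ∈ paths p (2 * k + 1) (rowVertex p k (l + p ^ k * t)),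
        g (extend P (evenVertex p k 1 l)) := by
  have h0 : 0 < p ^ k := by positivity
  rw [sum_paths_succ (n := 2 * k + 1) (I := Finset.range (p - 1))
    (f := fun t => rowVertex p k (l + p ^ k * t)) (by omega)
    (IsVertex.even k 1 l le_rfl hl)]
  · intro t _ t' _ h
    have := congrArg Hook.leg h
    simp only [rowVertex, Nat.add_left_cancel_iff] at this
    exact Nat.eq_of_mul_eq_mul_left h0 this
  · refine fun u => ⟨fun h => ?_, ?_⟩
    · obtain ⟨t, ht, h⟩ := edge_to_even_one hp h rfl rfl
      exact ⟨t, Finset.mem_range.2 ht, h⟩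
    · rintro ⟨t, ht, rfl⟩
      exact edge_even_one hp hl (Finset.mem_range.1 ht)

theorem add_pow_mul_lt_row {p k l t : ℕ} (hl : l < p ^ k) (ht : t < p - 1) :
    l + p ^ k * t < p ^ k * (p - 1) := by
  have : p ^ k * (t + 1) ≤ p ^ k * (p - 1) := Nat.mul_le_mul_left _ ht
  rw [mul_add] at this
  omega

/-- There are `p - 1` ways to enter the family from the first one, then `p` choices for every
further pair of floors. -/
theorem card_paths_even {p k : ℕ} (hp : 3 ≤ p) (s l : ℕ) (hl : l < p ^ k) :
    (paths p (2 * (k + (s + 1))) (evenVertex p k (s + 1) l)).card = (p - 1) * p ^ s := by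
  induction s generalizing l with
  | zero =>
    rw [Finset.card_eq_sum_ones]
    refine (sum_paths_even_one hp hl _).trans ?_
    rw [Finset.sum_congr rfl fun t ht => (Finset.card_eq_sum_ones _).symm.trans
      (card_paths_row hp k _ (add_pow_mul_lt_row hl (Finset.mem_range.1 ht)))]
    simp
  | succ s ih =>
    rw [Finset.card_eq_sum_ones]
    refine (sum_paths_even hp (by omega) hl _).trans ?_
    rw [Finset.sum_congr rfl fun t ht => (Finset.card_eq_sum_ones _).symm.trans
      (ih _ (add_pow_mul_div_lt hl (Finset.mem_range.1 ht)))]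
    simp only [Finset.sum_const, Finset.card_range, smul_eq_mul]
    ring

/-! ### Descents created by two more floors. -/

open Classical in
-- Only the positions `2r - 1` and `2r` involve a new block. Since `k < r`, the exceptional descent
-- at `2k` is decided by a block of `P`.
theorem card_descentSet_extend {p k r : ℕ} (P : Fin (2 * r) → Hook) (u v : Hook) (hr : k < r) :
    (descentSet p k (r := r + 1) (extend (extend P u) v)).card =
      (descentSet p k P).card +
      (if 2 * k + 2 ≤ 2 * r - 1 ∧ (blockAt P (2 * r - 1)).Gt ((vertexAt P (2 * r)).blockTo u)
        then 1 else 0) +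
      (if ((vertexAt P (2 * r)).blockTo u).Gt (u.blockTo v) then 1 else 0) := by
  have b1 : ∀ c < 2 * r, blockAt (extend (extend P u) v) c = blockAt P c := fun c hc => by
    rw [blockAt_extend_of_lt _ _ (by omega), blockAt_extend_of_lt _ _ hc]
  have b2 : blockAt (extend (extend P u) v) (2 * r) = (vertexAt P (2 * r)).blockTo u := by
    rw [blockAt_extend_of_lt _ _ (by omega), blockAt_extend_last _ _ (by omega)]
  have b3 : blockAt (extend (extend P u) v) (2 * r + 1) = u.blockTo v := by
    rw [blockAt_extend_last _ _ (by omega), vertexAt_extend_last]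
  have e : 2 * (r + 1) - 1 = 2 * r - 1 + 1 + 1 := by omega
  have e' : 2 * r - 1 + 1 = 2 * r := by omega
  unfold descentSet
  rw [Finset.card_filter, Finset.card_filter, e, Finset.sum_range_succ, Finset.sum_range_succ]
  congr 1
  · congr 1
    · refine Finset.sum_congr rfl fun i hi => ?_
      rw [Finset.mem_range] at hi
      have hb : blockAt (extend (extend P u) v) (2 * k + 1) = blockAt P (2 * k + 1) :=
        b1 _ (by omega)
      have hb1 := b1 i (by omega)
      have hb2 := b1 (i + 1) (by omega)
      refine if_congr ?_ rfl rfl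
      rw [← hb, ← hb1, ← hb2]
    · refine if_congr ?_ rfl rfl
      have hb := b1 (2 * r - 1) (by omega)
      rw [← hb, ← b2]
      have : 2 * r - 1 ≠ 2 * k := by omega
      simp only [this, false_and, or_false, e']
  · refine if_congr ?_ rfl rfl
    rw [← b2, ← b3]
    have h1 : 2 * r ≠ 2 * k := by omega
    have h2 : 2 * k + 2 ≤ 2 * r := by omega
    simp only [e', h1, h2, false_and, or_false, true_and]

/-! ### Lexicographic comparison of base-`p` digits. -/

/-- The common shape of the comparisons below: the first digit decides, and `Q` breaks a tie. -/
theorem card_filter_lt_or {h p : ℕ} (hh : h < p) (Q : ℕ → Prop) [DecidablePred Q] :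
    ((Finset.range p).filter fun t => t < h ∨ (t = h ∧ Q t)).card = h + if Q h then 1 else 0 := by
  split_ifs with hQ
  · have : (Finset.range p).filter (fun t => t < h ∨ (t = h ∧ Q t)) = Finset.range (h + 1) := by
      ext t
      simp only [Finset.mem_filter, Finset.mem_range]
      constructor
      · omega
      · intro ht
        rcases Nat.lt_or_ge t h with h1 | h1
        · exact ⟨by omega, Or.inl h1⟩
        · obtain rfl : t = h := by omega
          exact ⟨hh, Or.inr ⟨rfl, hQ⟩⟩
    rw [this, Finset.card_range]
  · have : (Finset.range p).filter (fun t => t < h ∨ (t = h ∧ Q t)) = Finset.range h := by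
      ext t
      simp only [Finset.mem_filter, Finset.mem_range]
      constructor
      · rintro ⟨-, h1 | ⟨rfl, h1⟩⟩
        · exact h1
        · exact absurd h1 hQ
      · exact fun ht => ⟨by omega, Or.inl ht⟩
    rw [this, Finset.card_range, add_zero]

theorem sum_card_filter_lt_or {h p : ℕ} (hp : p = 2 * h + 1) (Q : ℕ → Prop) [DecidablePred Q] :
    ∑ t ∈ Finset.range p, ((Finset.range p).filter fun x => x < t ∨ (x = t ∧ Q x)).card =
      p * h + ((Finset.range p).filter Q).card := by
  rw [Finset.sum_congr rfl fun t ht => card_filter_lt_or (Finset.mem_range.1 ht) Q,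
    Finset.sum_add_distrib, Finset.card_filter, Finset.sum_range_id]
  congr 1
  rw [hp, show (2 * h + 1) * (2 * h + 1 - 1) = (2 * h + 1) * h * 2 by
    rw [Nat.add_sub_cancel]; ring, Nat.mul_div_cancel _ two_pos]

/-- The geometric sum in a form free of division. -/
theorem sub_one_mul_powSum {p k n : ℕ} (hp : 1 ≤ p) (hk : 1 ≤ k) (hn : n ≤ k) :
    (p - 1) * powSum p n (k - 1) + p ^ n = p ^ k := by
  have h1 : Finset.Icc n (k - 1) = Finset.Ico n k := by
    ext; simp only [Finset.mem_Icc, Finset.mem_Ico]; omega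
  rw [powSum, h1]
  induction k, hn using Nat.le_induction with
  | base => simp
  | succ k hn ih =>
    rcases Nat.eq_zero_or_pos k with rfl | hk'
    · obtain rfl : n = 0 := by omega
      simp; omega
    · rw [Finset.sum_Ico_succ_top hn, mul_add, add_right_comm, ih hk' (by
        ext; simp only [Finset.mem_Icc, Finset.mem_Ico]; omega)]
      obtain ⟨q, rfl⟩ : ∃ q, p = q + 1 := ⟨p - 1, by omega⟩
      simp only [Nat.add_sub_cancel]
      ring

theorem powSum_eq_add {p k n : ℕ} (hn : n < k) :
    powSum p n (k - 1) = p ^ n + powSum p (n + 1) (k - 1) := by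
  unfold powSum
  rw [← Finset.add_sum_Ioc_eq_sum_Icc (by omega), Finset.Icc_add_one_left_eq_Ioc]

theorem powSum_mul {p k n : ℕ} (hp : 1 ≤ p) (hn : n < k) :
    powSum p n (k - 1) * p = powSum p (n + 1) (k - 1) + p ^ k := by
  have h1 := sub_one_mul_powSum hp (by omega) hn.le
  have h2 := powSum_eq_add (p := p) hn
  obtain ⟨q, rfl⟩ : ∃ q, p = q + 1 := ⟨p - 1, by omega⟩
  simp only [Nat.add_sub_cancel] at h1
  linarith

/-- Whether the `k - n` leading digits of `l` in base `p = 2h + 1` are lexicographically below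
`h, h, …, h`. -/
def alpha (p h k n l : ℕ) : ℕ := if l < h * powSum p n (k - 1) then 1 else 0

/-- The number of digits `x` such that the `k - n` leading digits of `l` in base `p` are
lexicographically above `x, x, …, x`. -/
def beta (p k n l : ℕ) : ℕ :=
  ((Finset.range p).filter fun x => x * powSum p n (k - 1) + p ^ n ≤ l).card

/-- The leading digits of `(l + p^k t) / p` are `t` followed by leading digits of `l`. So `t < h`
always counts, `t > h` never, and `t = h` passes the comparison on to one digit fewer of `l`. -/
theorem sum_alpha {p h k n l : ℕ} (hp : p = 2 * h + 1) (hn : n < k) (hl : l < p ^ k) :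
    ∑ t ∈ Finset.range p, alpha p h k n ((l + p ^ k * t) / p) = h + alpha p h k (n + 1) l := by
  have h1 := sub_one_mul_powSum (p := p) (by omega) (by omega) (show n + 1 ≤ k from hn)
  have h2 := powSum_mul (p := p) (by omega) hn
  have h3 : h * powSum p (n + 1) (k - 1) ≤ p ^ k := by
    rw [← h1, show p - 1 = 2 * h by omega]
    nlinarith [Nat.zero_le (h * powSum p (n + 1) (k - 1)), Nat.zero_le (p ^ (n + 1))]
  rw [alpha, ← card_filter_lt_or (show h < p by omega)
    (fun _ => l < h * powSum p (n + 1) (k - 1)), Finset.card_filter]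
  refine Finset.sum_congr rfl fun t _ => if_congr ?_ rfl rfl
  rw [Nat.div_lt_iff_lt_mul (by omega), mul_assoc, h2]
  rcases lt_trichotomy t h with ht | rfl | ht
  · have : p ^ k * (t + 1) ≤ p ^ k * h := Nat.mul_le_mul_left _ ht
    simp only [ht, true_or, iff_true]
    nlinarith
  · simp only [lt_self_iff_false, true_and, false_or, mul_add, mul_comm t (p ^ k)]
    omega
  · have : p ^ k * (h + 1) ≤ p ^ k * t := Nat.mul_le_mul_left _ ht
    simp only [ht.not_gt, ht.ne', false_and, false_or, iff_false, not_lt]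
    nlinarith

/-- As for `sum_alpha`: the pairs `x < t` give `p h`, and each tie `x = t` leaves a comparison of
`l` with `x, x, …, x`. -/
theorem sum_beta {p h k n l : ℕ} (hp : p = 2 * h + 1) (hn : n < k) (hl : l < p ^ k) :
    ∑ t ∈ Finset.range p, beta p k n ((l + p ^ k * t) / p) = p * h + beta p k (n + 1) l := by
  have h1 := sub_one_mul_powSum (p := p) (by omega) (by omega) (show n + 1 ≤ k from hn)
  have h2 := powSum_mul (p := p) (by omega) hn
  unfold beta
  rw [← sum_card_filter_lt_or hp]
  refine Finset.sum_congr rfl fun t _ => congrArg _ (Finset.filter_congr fun x hx => ?_)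
  rw [Finset.mem_range] at hx
  have h3 : x * powSum p (n + 1) (k - 1) + p ^ (n + 1) ≤ p ^ k :=
    (Nat.add_le_add_right (Nat.mul_le_mul_right _ (by omega)) _).trans h1.le
  rw [Nat.le_div_iff_mul_le (by omega), add_mul, mul_assoc, h2, ← pow_succ, mul_add,
    mul_comm x (p ^ k)]
  rcases lt_trichotomy x t with ht | rfl | ht
  · have : p ^ k * (x + 1) ≤ p ^ k * t := Nat.mul_le_mul_left _ ht
    rw [mul_add] at this
    simp only [ht, true_or, iff_true]
    omega
  · simp only [lt_self_iff_false, true_and, false_or]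
    omega
  · have : p ^ k * (t + 1) ≤ p ^ k * x := Nat.mul_le_mul_left _ ht
    rw [mul_add] at this
    simp only [ht.not_gt, ht.ne', false_and, false_or, iff_false]
    omega

theorem div_add_pow_le {p k l t : ℕ} (hl : l < p ^ k) (ht : t < p) :
    (l + p ^ k * t) / p ≤ l + p ^ k * t ∧ (l + p ^ k * t) / p < p ^ k :=
  ⟨Nat.div_le_self _ _, add_pow_mul_div_lt hl ht⟩

/-- Counts the `t` for which the two new blocks form a descent; see `gt_up_down`. -/
theorem card_vert_lt {p h k l : ℕ} (hp : p = 2 * h + 1) (hh : 1 ≤ h) (hk : 1 ≤ k)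
    (hl : l < p ^ k) :
    ((Finset.range p).filter fun t =>
      l + p ^ k * t - (l + p ^ k * t) / p < p ^ k * (p - 1 - t)).card = h + alpha p h k 0 l := by
  have h1 := sub_one_mul_powSum (p := p) (by omega) hk (Nat.zero_le k)
  rw [alpha, ← card_filter_lt_or (show h < p by omega) (fun _ => l < h * powSum p 0 (k - 1))]
  refine congrArg _ (Finset.filter_congr fun t ht => ?_)
  rw [Finset.mem_range] at ht
  obtain ⟨h2, h3⟩ := div_add_pow_le hl ht
  rcases lt_trichotomy t h with h4 | rfl | h4
  · have : p ^ k * (t + 1) ≤ p ^ k * (p - 1 - t) := Nat.mul_le_mul_left _ (by omega)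
    rw [mul_add] at this
    generalize (l + p ^ k * t) / p = m at *
    simp only [h4, true_or, iff_true]
    omega
  -- The tie `t = h`: the test is `l + 1 ≤ (l + p^k h) / p`. With `p^k = 2hσ + 1` it says `2h (l +
  -- 1) ≤ 2h (hσ) + (h - 1)`, and the remainder `h - 1 < 2h` is irrelevant for integers.
  · have h5 : p - 1 - t = t := by omega
    have h6 : l + p ^ k * t - (l + p ^ k * t) / p < p ^ k * t ↔
        l + 1 ≤ (l + p ^ k * t) / p := by omega
    simp only [lt_self_iff_false, true_and, false_or, h5, h6]
    rw [Nat.le_div_iff_mul_le (by omega), ← h1, show p - 1 = 2 * t by omega, hp]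
    generalize powSum (2 * t + 1) 0 (k - 1) = σ
    constructor
    · intro h
      by_contra! h7
      nlinarith
    · intro h
      nlinarith
  · have : p ^ k * (p - 1 - t + 1) ≤ p ^ k * (t - 1) := Nat.mul_le_mul_left _ (by omega)
    have h5 : p ^ k * (t - 1 + 1) = p ^ k * t := by congr 1; omega
    rw [mul_add] at this h5
    simp only [h4.not_gt, h4.ne', false_and, false_or, iff_false]
    omega

/-- Counts the descents between the preceding block, with digit `x`, and the first new block, with
digit `t`; see `gt_down_up`. -/
theorem sum_card_lt_vert {p h k l : ℕ} (hp : p = 2 * h + 1) (hh : 1 ≤ h) (hk : 1 ≤ k)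
    (hl : l < p ^ k) :
    ∑ t ∈ Finset.range p, ((Finset.range p).filter fun x =>
      p ^ k * (p - 1 - x) < l + p ^ k * t - (l + p ^ k * t) / p).card =
      p * h + beta p k 0 l := by
  have h1 := sub_one_mul_powSum (p := p) (by omega) hk (Nat.zero_le k)
  rw [beta, ← sum_card_filter_lt_or hp]
  refine Finset.sum_congr rfl fun t ht => ?_
  rw [Finset.mem_range] at ht
  obtain ⟨h2, h3⟩ := div_add_pow_le hl ht
  -- Replacing `x` by `p - 1 - x` turns the test into `p^k x < m - m / p` with `m = l + p^k t`.
  rw [Finset.card_filter, Finset.card_filter, ← Finset.sum_range_reflect]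
  refine Finset.sum_congr rfl fun x hx => if_congr ?_ rfl rfl
  rw [Finset.mem_range] at hx
  rw [show p - 1 - (p - 1 - x) = x by omega]
  rcases lt_trichotomy x t with h4 | rfl | h4
  · have : p ^ k * (x + 1) ≤ p ^ k * t := Nat.mul_le_mul_left _ h4
    rw [mul_add] at this
    simp only [h4, true_or, iff_true]
    omega
  · have h6 : p ^ k * x < l + p ^ k * x - (l + p ^ k * x) / p ↔ (l + p ^ k * x) / p < l := by omega
    simp only [lt_self_iff_false, true_and, false_or, h6]
    rw [Nat.div_lt_iff_lt_mul (by omega), ← h1]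
    rw [← h1] at hl
    obtain ⟨q, rfl⟩ : ∃ q, p = q + 1 := ⟨p - 1, by omega⟩
    simp only [Nat.add_sub_cancel] at hl ⊢
    generalize powSum (q + 1) 0 (k - 1) = σ at *
    simp only [pow_zero] at *
    constructor
    · intro h
      by_contra! h7
      nlinarith
    · intro h7
      -- The digit `x = p - 1` cannot occur, since it would force `p^k ≤ l`.
      have h8 : x < q := by
        rcases Nat.lt_or_ge x q with h9 | h9
        · exact h9
        · obtain rfl : x = q := by omega
          omega
      nlinarith
  · have : p ^ k * (t + 1) ≤ p ^ k * x := Nat.mul_le_mul_left _ h4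
    rw [mul_add] at this
    simp only [h4.not_gt, h4.ne', false_and, false_or, iff_false]
    generalize (l + p ^ k * t) / p = m at *
    omega

/-! ### The recursion for the Fibonacci numbers. -/

theorem blockTo_up_div {p k s m : ℕ} (hp : 3 ≤ p) (hs : 1 ≤ s) (hm : m < p ^ (k + 1)) :
    (evenVertex p k s (m / p)).blockTo (oddVertex p k (s + 1) m) =
      ⟨p ^ k * (p - 1) - (m - m / p), m - m / p⟩ := by
  have h1 : m / p < p ^ k := Nat.div_lt_of_lt_mul (by rwa [← pow_succ'])
  have h2 : m % p < p := Nat.mod_lt _ (by omega)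
  have h3 := blockTo_up hp hs h1 (t := m % p) (by omega)
  have h4 : (p - 1) * (m / p) + m % p = m - m / p := by
    have h5 := Nat.div_add_mod m p
    have h6 : p * (m / p) = (p - 1) * (m / p) + m / p := by
      obtain ⟨q, rfl⟩ : ∃ q, p = q + 1 := ⟨p - 1, by omega⟩
      rw [Nat.add_sub_cancel]; ring
    omega
  rwa [Nat.div_add_mod, h4] at h3

theorem sub_div_le {p k m : ℕ} (hp : 3 ≤ p) (hm : m < p ^ (k + 1)) :
    m - m / p ≤ p ^ k * (p - 1) := by
  obtain ⟨q, rfl⟩ : ∃ q, p = q + 1 := ⟨p - 1, by omega⟩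
  rw [Nat.add_sub_cancel]
  have h5 := Nat.div_add_mod m (q + 1)
  have h1 : m / (q + 1) < (q + 1) ^ k := Nat.div_lt_of_lt_mul (by rwa [← pow_succ'])
  have h2 : m % (q + 1) < q + 1 := Nat.mod_lt _ (by omega)
  have h3 : q * (m / (q + 1) + 1) ≤ q * (q + 1) ^ k := Nat.mul_le_mul_left _ h1
  generalize m / (q + 1) = a at *
  generalize m % (q + 1) = b at *
  have h4 : (q + 1) * a = q * a + a := by ring
  rw [mul_comm ((q + 1) ^ k)]
  rw [mul_add] at h3
  omega

theorem mul_add_mul_sub {p X t : ℕ} (ht : t < p) :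
    X * t + X * (p - 1 - t) = X * (p - 1) := by
  rw [← mul_add]; congr 1; omega

theorem gt_up_down {p X V t : ℕ} (hV : V ≤ X * (p - 1)) (ht : t < p) :
    (Block.mk (X * (p - 1) - V) V).Gt ⟨X * t, X * (p - 1 - t)⟩ ↔ V < X * (p - 1 - t) := by
  have := mul_add_mul_sub (X := X) ht
  simp only [Block.Gt]
  omega

theorem gt_down_up {p X V t : ℕ} (hV : V ≤ X * (p - 1)) (ht : t < p) :
    (Block.mk (X * t) (X * (p - 1 - t))).Gt ⟨X * (p - 1) - V, V⟩ ↔ X * (p - 1 - t) < V := by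
  have := mul_add_mul_sub (X := X) ht
  simp only [Block.Gt]
  omega

open Classical in
theorem fibonacciNumber_succ {p k s l : ℕ} (hp : 3 ≤ p) (hs : 1 ≤ s) (hl : l < p ^ k) :
    fibonacciNumber p k (k + (s + 1)) (evenVertex p k (s + 1) l) =
      ∑ t ∈ Finset.range p, (fibonacciNumber p k (k + s) (evenVertex p k s ((l + p ^ k * t) / p)) +
        ∑ P ∈ paths p (2 * (k + s)) (evenVertex p k s ((l + p ^ k * t) / p)),
          ((if 2 * k + 2 ≤ 2 * (k + s) - 1 ∧ (blockAt P (2 * (k + s) - 1)).Gt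
            ⟨p ^ k * (p - 1) - (l + p ^ k * t - (l + p ^ k * t) / p),
              l + p ^ k * t - (l + p ^ k * t) / p⟩ then 1 else 0) +
          (if l + p ^ k * t - (l + p ^ k * t) / p < p ^ k * (p - 1 - t) then 1 else 0))) := by
  rw [fibonacciNumber_eq_sum]
  refine (sum_paths_even hp hs hl _).trans ?_
  refine Finset.sum_congr rfl fun t ht => ?_
  rw [Finset.mem_range] at ht
  rw [fibonacciNumber_eq_sum, ← Finset.sum_add_distrib]
  refine Finset.sum_congr rfl fun P hP => ?_
  have h1 := (mem_paths.1 hP).last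
  have h2 := blockTo_up_div hp hs (add_pow_mul_lt hl ht)
  have h3 := blockTo_down hp hs hl (t := t) (by omega)
  refine (card_descentSet_extend (r := k + s) P _ _ (by omega)).trans ?_
  rw [h1, h2, h3, add_assoc]
  congr 2
  exact if_congr (gt_up_down (sub_div_le hp (add_pow_mul_lt hl ht)) ht) rfl rfl

/-- Only the exceptional descent at `2k` is possible, and it occurs for `h` of the `p - 1` paths. -/
theorem fibonacciNumber_one {p h k l : ℕ} (hp : p = 2 * h + 1) (hh : 1 ≤ h) (hl : l < p ^ k) :
    fibonacciNumber p k (k + 1) (evenVertex p k 1 l) = h := by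
  classical
  rw [fibonacciNumber_eq_sum]
  refine (sum_paths_even_one (by omega) hl _).trans ?_
  have key : ∀ t ∈ Finset.range (p - 1),
      ∑ P ∈ paths p (2 * k + 1) (rowVertex p k (l + p ^ k * t)),
        (descentSet p k (r := k + 1) (extend P (evenVertex p k 1 l))).card =
      if t < h then 1 else 0 := by
    intro t ht
    rw [Finset.mem_range] at ht
    have h1 := card_paths_row (p := p) (by omega) k _ (add_pow_mul_lt_row hl ht)
    rw [Finset.sum_congr rfl (g := fun _ => if t < h then 1 else 0), Finset.sum_const, h1,
      one_smul]
    intro P hP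
    have h2 : blockAt (extend P (evenVertex p k 1 l)) (2 * k + 1) =
        ⟨p ^ k * t, p ^ k * (p - 2 - t)⟩ := by
      rw [blockAt_extend_last _ _ (by omega), (mem_paths.1 hP).last,
        blockTo_turn (by omega) hl (by omega)]
    have h3 : (∃ t' < (p - 1) / 2, (⟨p ^ k * t, p ^ k * (p - 2 - t)⟩ : Block) =
        ⟨p ^ k * t', p ^ k * (p - 2 - t')⟩) ↔ t < h := by
      constructor
      · rintro ⟨t', ht', h4⟩
        have h5 := congrArg Block.horiz h4
        have := Nat.eq_of_mul_eq_mul_left (Nat.pow_pos (by omega)) h5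
        omega
      · exact fun h4 => ⟨t, by omega, rfl⟩
    have h4 : descentSet p k (r := k + 1) (extend P (evenVertex p k 1 l)) =
        if t < h then {2 * k} else ∅ := by
      ext i
      have h2' : blockAt (n := 2 * (k + 1)) (extend P (evenVertex p k 1 l)) (2 * k + 1) =
        ⟨p ^ k * t, p ^ k * (p - 2 - t)⟩ := h2
      simp only [descentSet, Finset.mem_filter, Finset.mem_range, h2', h3]
      split_ifs with h5
      · simp only [h5, and_true, Finset.mem_singleton]
        omega
      · simp only [h5, and_false, or_false, Finset.notMem_empty, iff_false]
        omega
    rw [h4]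
    split_ifs <;> rfl
  rw [Finset.sum_congr rfl key, ← Finset.card_filter,
    show (Finset.range (p - 1)).filter (fun t => t < h) = Finset.range h by
      ext t; simp only [Finset.mem_filter, Finset.mem_range]; omega, Finset.card_range]

theorem fibonacciNumber_two {p h k l : ℕ} (hp : p = 2 * h + 1) (hh : 1 ≤ h) (hk : 1 ≤ k)
    (hl : l < p ^ k) :
    fibonacciNumber p k (k + 2) (evenVertex p k 2 l) =
      p * h + (p - 1) * (h + alpha p h k 0 l) := by
  classical
  rw [fibonacciNumber_succ (s := 1) (by omega) le_rfl hl, ← card_vert_lt hp hh hk hl,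
    Finset.card_filter, Finset.mul_sum]
  -- Position `2k + 1` is not allowed as a descent, so no `beta` term arises here.
  simp only [show ¬ 2 * k + 2 ≤ 2 * (k + 1) - 1 by omega, false_and, if_false, zero_add]
  rw [Finset.sum_add_distrib]
  congr 1
  · rw [Finset.sum_congr rfl fun t ht => fibonacciNumber_one hp hh
      (add_pow_mul_div_lt hl (Finset.mem_range.1 ht))]
    simp
  · refine Finset.sum_congr rfl fun t ht => ?_
    rw [Finset.sum_const, card_paths_even (by omega) 0 _
      (add_pow_mul_div_lt hl (Finset.mem_range.1 ht))]
    simp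

/-- The last block depends only on the last inserted digit, and each digit is shared by `(p - 1)
p^s` paths. -/
theorem sum_paths_gt {p h k s l V : ℕ} [DecidableRel Block.Gt] (hp : p = 2 * h + 1) (hh : 1 ≤ h)
    (hl : l < p ^ k) (hV : V ≤ p ^ k * (p - 1)) :
    ∑ P ∈ paths p (2 * (k + (s + 2))) (evenVertex p k (s + 2) l),
      (if (blockAt P (2 * (k + (s + 2)) - 1)).Gt ⟨p ^ k * (p - 1) - V, V⟩ then 1 else 0) =
      (p - 1) * p ^ s * ((Finset.range p).filter fun x => p ^ k * (p - 1 - x) < V).card := by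
  refine (sum_paths_even (s := s + 1) (by omega) (by omega) hl _).trans ?_
  rw [Finset.card_filter, Finset.mul_sum]
  refine Finset.sum_congr rfl fun t ht => ?_
  rw [Finset.mem_range] at ht
  refine Eq.trans (Finset.sum_congr (g := fun _ => if p ^ k * (p - 1 - t) < V then 1 else 0) rfl
    fun P hP => if_congr ?_ rfl rfl) ?_
  swap
  · rw [Finset.sum_const, card_paths_even (by omega) s _ (add_pow_mul_div_lt hl ht), smul_eq_mul]
  rw [show 2 * (k + (s + 2)) - 1 = 2 * (k + (s + 1)) + 1 by omega]
  refine Iff.trans ?_ (gt_down_up hV ht)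
  refine iff_of_eq (congrArg (fun B => Block.Gt B _) ?_)
  refine (blockAt_extend_last (n := 2 * (k + (s + 1)) + 1) _ _ (by omega)).trans ?_
  rw [vertexAt_extend_last, blockTo_down (by omega) (by omega) hl (by omega)]

theorem fibonacciNumber_add_three {p h k s l : ℕ} (hp : p = 2 * h + 1) (hh : 1 ≤ h) (hk : 1 ≤ k)
    (hl : l < p ^ k) :
    fibonacciNumber p k (k + (s + 3)) (evenVertex p k (s + 3) l) =
      ∑ t ∈ Finset.range p,
        fibonacciNumber p k (k + (s + 2)) (evenVertex p k (s + 2) ((l + p ^ k * t) / p)) +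
      (p - 1) * p ^ s * (p * h + beta p k 0 l) +
      (p - 1) * p ^ (s + 1) * (h + alpha p h k 0 l) := by
  classical
  rw [fibonacciNumber_succ (s := s + 2) (by omega) (by omega) hl, ← card_vert_lt hp hh hk hl,
    ← sum_card_lt_vert hp hh hk hl, Finset.card_filter, Finset.mul_sum, Finset.mul_sum,
    ← Finset.sum_add_distrib, ← Finset.sum_add_distrib]
  refine Finset.sum_congr rfl fun t ht => ?_
  rw [Finset.mem_range] at ht
  have h1 := add_pow_mul_div_lt hl ht
  simp only [show 2 * k + 2 ≤ 2 * (k + (s + 2)) - 1 by omega, true_and]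
  rw [Finset.sum_add_distrib, sum_paths_gt hp hh h1 (sub_div_le (by omega) (add_pow_mul_lt hl ht)),
    Finset.sum_const, card_paths_even (by omega) (s + 1) _ h1, smul_eq_mul, add_assoc]

/-! ### Solving the recursion. -/

/-- The `p^(k)`-Fibonacci number in terms of the digits of `l`. -/
theorem fibonacciNumber_eq {p h k : ℕ} (hp : p = 2 * h + 1) (hh : 1 ≤ h) (m l : ℕ) (hm : m < k)
    (hl : l < p ^ k) :
    (fibonacciNumber p k (k + (m + 2)) (evenVertex p k (m + 2) l) : ℚ) =
      h * (2 * (m + 1) * p ^ (m + 1) +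
        ∑ n ∈ Finset.range (m + 1), (2 * (alpha p h k n l : ℚ) - 1) * p ^ (m - n) +
        ∑ n ∈ Finset.range m, (2 * (beta p k n l : ℚ) - p) * p ^ (m - (n + 1))) := by
  have hpq : ((p - 1 : ℕ) : ℚ) = 2 * h := by
    rw [show p - 1 = 2 * h by omega]; push_cast; ring
  have hpq' : (p : ℚ) = 2 * h + 1 := by rw [hp]; push_cast; ring
  induction m generalizing l with
  | zero =>
    rw [fibonacciNumber_two hp hh (by omega) hl]
    push_cast [hpq]
    simp
    rw [hpq']
    ring
  | succ m ih =>
    rw [fibonacciNumber_add_three hp hh (by omega) hl]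
    push_cast [hpq]
    rw [Finset.sum_congr rfl fun t ht => ih _ (by omega)
      (add_pow_mul_div_lt hl (Finset.mem_range.1 ht)), ← Finset.mul_sum, Finset.sum_add_distrib,
      Finset.sum_add_distrib, Finset.sum_comm, Finset.sum_comm (t := Finset.range m)]
    -- The centred quantities `2α - 1` and `2β - p` absorb the constants of `sum_alpha` and
    -- `sum_beta`: summing over `t` merely shifts `n` to `n + 1`.
    have h1 : ∀ n ∈ Finset.range (m + 1), ∑ t ∈ Finset.range p,
        (2 * (alpha p h k n ((l + p ^ k * t) / p) : ℚ) - 1) * p ^ (m - n) =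
        (2 * (alpha p h k (n + 1) l : ℚ) - 1) * p ^ (m + 1 - (n + 1)) := by
      intro n hn
      rw [Finset.mem_range] at hn
      rw [← Finset.sum_mul, Finset.sum_sub_distrib, ← Finset.mul_sum, ← Nat.cast_sum,
        sum_alpha hp (by omega) hl, Nat.add_sub_add_right]
      congr 1
      simp only [Finset.sum_const, Finset.card_range, nsmul_eq_mul]
      push_cast
      rw [hpq']
      ring
    have h2 : ∀ n ∈ Finset.range m, ∑ t ∈ Finset.range p,
        (2 * (beta p k n ((l + p ^ k * t) / p) : ℚ) - p) * p ^ (m - (n + 1)) =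
        (2 * (beta p k (n + 1) l : ℚ) - p) * p ^ (m - (n + 1)) := by
      intro n hn
      rw [Finset.mem_range] at hn
      rw [← Finset.sum_mul, Finset.sum_sub_distrib, ← Finset.mul_sum, ← Nat.cast_sum,
        sum_beta hp (by omega) hl]
      congr 1
      simp only [Finset.sum_const, Finset.card_range, nsmul_eq_mul]
      push_cast
      rw [hpq']
      ring
    rw [Finset.sum_congr rfl h1, Finset.sum_congr rfl h2,
      Finset.sum_range_succ' (fun n => (2 * (alpha p h k n l : ℚ) - 1) * p ^ (m + 1 - n)) (m + 1),
      Finset.sum_range_succ' (fun n => (2 * (beta p k n l : ℚ) - p) * p ^ (m - n)) m]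
    generalize ∑ n ∈ Finset.range (m + 1),
      (2 * (alpha p h k (n + 1) l : ℚ) - 1) * p ^ (m + 1 - (n + 1)) = A
    generalize ∑ n ∈ Finset.range m,
      (2 * (beta p k (n + 1) l : ℚ) - p) * p ^ (m - (n + 1)) = B
    simp only [Finset.sum_const, Finset.card_range, nsmul_eq_mul, Nat.sub_zero]
    rw [hpq']
    ring

/-! ### Locating `l` among the jumps of `alpha` and `beta`. -/

theorem powSum_antitone {p a b c : ℕ} (h : a ≤ b) : powSum p b c ≤ powSum p a c :=
  Finset.sum_le_sum_of_subset (Finset.Icc_subset_Icc_left h)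

theorem pow_le_powSum {p a c : ℕ} (h : a ≤ c) : p ^ a ≤ powSum p 0 c :=
  Finset.single_le_sum (f := fun j => p ^ j) (fun _ _ => Nat.zero_le _)
    (Finset.mem_Icc.2 ⟨Nat.zero_le _, h⟩)

/-- The least `l < p^k` whose `k - n` leading digits in base `p` are above `x, x, …, x`. -/
def threshold (p k x n : ℕ) : ℕ := x * powSum p n (k - 1) + p ^ n

/-- Passing from `n` to `n + 1` replaces `(x + 1) p^n` by `p^(n+1)`. Together with
`threshold_le_threshold_succ`, this puts the thresholds with `n < k` in a single increasing chain,
ordered by `x` first and then by `n`. -/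
theorem threshold_mono_right {p k x n n' : ℕ} (hx : x < p) (hn : n ≤ n') (hk : n' ≤ k) :
    threshold p k x n ≤ threshold p k x n' := by
  induction n', hn using Nat.le_induction with
  | base => exact le_rfl
  | succ n' hn ih =>
    refine (ih (by omega)).trans ?_
    have : (x + 1) * p ^ n' ≤ p * p ^ n' := Nat.mul_le_mul_right _ hx
    rw [threshold, threshold, powSum_eq_add (by omega), pow_succ]
    nlinarith

theorem threshold_mono_left {p k x x' n : ℕ} (hx : x ≤ x') :
    threshold p k x n ≤ threshold p k x' n :=
  Nat.add_le_add_right (Nat.mul_le_mul_right _ hx) _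

theorem threshold_zero {p k x : ℕ} : threshold p k x 0 = x * powSum p 0 (k - 1) + 1 := rfl

theorem threshold_le_threshold_succ {p k x n : ℕ} (hn : n < k) :
    threshold p k x n ≤ threshold p k (x + 1) 0 := by
  have h1 := powSum_antitone (p := p) (c := k - 1) (Nat.zero_le n)
  have h2 := pow_le_powSum (p := p) (show n ≤ k - 1 by omega)
  have h3 : x * powSum p n (k - 1) ≤ x * powSum p 0 (k - 1) := Nat.mul_le_mul_left _ h1
  rw [threshold, threshold_zero, add_mul]
  omega

theorem beta_eq_of_forall {p k n l c : ℕ} (hc : c ≤ p) (h : ∀ x < p, threshold p k x n ≤ l ↔ x < c) :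
    beta p k n l = c := by
  have : (Finset.range p).filter (fun x => x * powSum p n (k - 1) + p ^ n ≤ l) =
      Finset.range c := by
    ext x
    simp only [Finset.mem_filter, Finset.mem_range]
    constructor
    · exact fun hx => (h x hx.1).1 hx.2
    · exact fun hx => ⟨by omega, (h x (by omega)).2 hx⟩
  rw [beta, this, Finset.card_range]

theorem beta_zero_right {p k n : ℕ} (hp : 1 ≤ p) : beta p k n 0 = 0 := by
  refine beta_eq_of_forall (Nat.zero_le _) fun x _ => ?_
  have : 0 < p ^ n := Nat.pow_pos hp
  rw [threshold]
  omega

/-- In the chain of thresholds, `l` lies between two neighbours of row `c`: all rows `x < c` are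
passed, no row `x > c` is, and row `c` is passed exactly up to `i`. -/
theorem beta_of_mem_Ico {p k n l c i : ℕ} (hc : c < p) (hi : i + 1 < k) (hn : n < k)
    (h1 : threshold p k c i ≤ l) (h2 : l < threshold p k c (i + 1)) :
    beta p k n l = c + if n < i + 1 then 1 else 0 := by
  refine beta_eq_of_forall (by split_ifs <;> omega) fun x hx => ?_
  rcases lt_trichotomy x c with h | rfl | h
  · have h3 : threshold p k x n ≤ l := calc
      _ ≤ threshold p k (x + 1) 0 := threshold_le_threshold_succ hn
      _ ≤ threshold p k c 0 := threshold_mono_left h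
      _ ≤ threshold p k c i := threshold_mono_right hc (Nat.zero_le _) (by omega)
      _ ≤ l := h1
    exact iff_of_true h3 (by omega)
  · split_ifs with h4
    · exact iff_of_true ((threshold_mono_right hc (by omega) (by omega)).trans h1) (by omega)
    · refine iff_of_false (not_le.2 (h2.trans_le ?_)) (by omega)
      exact threshold_mono_right hc (by omega) hn.le
  · have h3 : l < threshold p k x n := calc
      l < threshold p k c (i + 1) := h2
      _ ≤ threshold p k (c + 1) 0 := threshold_le_threshold_succ hi
      _ ≤ threshold p k x 0 := threshold_mono_left h
      _ ≤ threshold p k x n := threshold_mono_right hx (Nat.zero_le _) hn.le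
    exact iff_of_false (not_le.2 h3) (by split_ifs <;> omega)

theorem beta_of_le {p k n l c i : ℕ} (hc : c < p) (hi : i < k) (hn : n ≤ i)
    (h1 : threshold p k c i ≤ l) (h2 : l ≤ (c + 1) * powSum p 0 (k - 1)) :
    beta p k n l = c + 1 := by
  refine beta_eq_of_forall hc fun x hx => ?_
  rcases Nat.lt_or_ge c x with h | h
  · have h3 : l < threshold p k x n := calc
      l < threshold p k (c + 1) 0 := Nat.lt_succ_of_le h2
      _ ≤ threshold p k x 0 := threshold_mono_left h
      _ ≤ threshold p k x n := threshold_mono_right hx (Nat.zero_le _) (by omega)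
    exact iff_of_false (not_le.2 h3) (by omega)
  · exact iff_of_true ((threshold_mono_left h).trans
      ((threshold_mono_right hc hn (by omega)).trans h1)) (by omega)

theorem alpha_of_lt {p h k n m l : ℕ} (hn : n ≤ m) (hl : l < h * powSum p m (k - 1)) :
    alpha p h k n l = 1 :=
  if_pos (hl.trans_le (Nat.mul_le_mul_left _ (powSum_antitone hn)))

theorem alpha_of_ge {p h k n m l : ℕ} (hn : m ≤ n) (hl : h * powSum p m (k - 1) ≤ l) :
    alpha p h k n l = 0 :=
  if_neg (not_lt.2 ((Nat.mul_le_mul_left _ (powSum_antitone hn)).trans hl))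

/-- The difference of the two sides is `powSum p (m + 1) (k - 1) - h p^m`, and the sum contains
`p^(m+1)`. This orders the jumps of `beta` for `x = h - 1` before those of `alpha`. -/
theorem threshold_le_mul_powSum {p h k m : ℕ} (hp : p = 2 * h + 1) (hh : 1 ≤ h) (hm : m + 1 < k) :
    threshold p k (h - 1) m ≤ h * powSum p (m + 1) (k - 1) := by
  obtain ⟨c, rfl⟩ : ∃ c, h = c + 1 := ⟨h - 1, by omega⟩
  have h1 := powSum_eq_add (p := p) hm
  have h2 := powSum_eq_add (p := p) (show m < k by omega)
  have h3 : (c + 1) * p ^ m ≤ p * p ^ m := Nat.mul_le_mul_right _ (by omega)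
  rw [threshold, h2, Nat.add_sub_cancel]
  rw [pow_succ] at h1
  nlinarith

/-- Multiplied by `2h = p - 1`, the claim becomes `h p^m < p^k + h - 1`. It makes every `alpha`
equal to one in the range of (b). -/
theorem pred_mul_powSum_lt {p h k m : ℕ} (hp : p = 2 * h + 1) (hh : 1 ≤ h) (hm : m < k) :
    (h - 1) * powSum p 0 (k - 1) < h * powSum p m (k - 1) := by
  obtain ⟨c, rfl⟩ : ∃ c, h = c + 1 := ⟨h - 1, by omega⟩
  have h1 := sub_one_mul_powSum (p := p) (by omega) (by omega) hm.le
  have h2 := sub_one_mul_powSum (p := p) (by omega) (by omega) (Nat.zero_le k)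
  have h3 : p ^ m * p ≤ p ^ k := by
    rw [← pow_succ]; exact Nat.pow_le_pow_right (by omega) hm
  rw [show p - 1 = 2 * (c + 1) by omega] at h1 h2
  rw [Nat.add_sub_cancel]
  generalize powSum p m (k - 1) = σ at *
  generalize powSum p 0 (k - 1) = τ at *
  generalize p ^ m = X at *
  generalize p ^ k = Y at *
  by_contra! h4
  subst hp
  nlinarith

/-! ### Geometric sums. -/

/-- The partial sums of the geometric series, as rational numbers. -/
def geom (p N : ℕ) : ℚ := ∑ n ∈ Finset.range N, (p : ℚ) ^ n

theorem geom_succ (p N : ℕ) : geom p (N + 1) = geom p N + (p : ℚ) ^ N :=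
  Finset.sum_range_succ _ _

theorem geom_succ' (p N : ℕ) : geom p (N + 1) = p * geom p N + 1 :=
  geom_sum_succ

theorem powSum_cast {p a b : ℕ} (h : a ≤ b + 1) :
    (powSum p a b : ℚ) = geom p (b + 1) - geom p a := by
  have : Finset.Icc a b = Finset.Ico a (b + 1) := by
    ext; simp only [Finset.mem_Icc, Finset.mem_Ico]; omega
  rw [powSum, this, geom, geom, ← Finset.sum_Ico_eq_sub _ h]
  push_cast
  rfl

theorem sum_ite_lt_mul_pow {p a : ℕ} (N : ℕ) (ha : a ≤ N) :
    ∑ n ∈ Finset.range N, (if n < a then (1 : ℚ) else 0) * (p : ℚ) ^ (N - (n + 1)) =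
      geom p N - geom p (N - a) := by
  induction a with
  | zero => simp
  | succ a ih =>
    have h1 : ∀ n ∈ Finset.range N, (if n < a + 1 then (1 : ℚ) else 0) * (p : ℚ) ^ (N - (n + 1)) =
        (if n < a then (1 : ℚ) else 0) * (p : ℚ) ^ (N - (n + 1)) +
        if n = a then (p : ℚ) ^ (N - (n + 1)) else 0 := by
      intro n _
      split_ifs <;> first | omega | simp
    rw [Finset.sum_congr rfl h1, Finset.sum_add_distrib, ih (by omega), Finset.sum_ite_eq',
      if_pos (Finset.mem_range.2 ha), show N - a = N - (a + 1) + 1 by omega, geom_succ]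
    ring

/-- Each interval of the theorem is an instance: `a` and `b` are the numbers of indices at which
`alpha` is one and at which `beta` exceeds `c`. -/
theorem fibonacciNumber_eq_geom {p h k m l a b c : ℕ} (hp : p = 2 * h + 1) (hh : 1 ≤ h)
    (hm : m < k) (hl : l < p ^ k) (ha : a ≤ m + 1) (hb : b ≤ m)
    (hα : ∀ n ≤ m, alpha p h k n l = if n < a then 1 else 0)
    (hβ : ∀ n < m, beta p k n l = c + if n < b then 1 else 0) :
    (fibonacciNumber p k (k + (m + 2)) (evenVertex p k (m + 2) l) : ℚ) =
      h * (2 * (m + 1) * p ^ (m + 1) + (geom p (m + 1) - 2 * geom p (m + 1 - a)) +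
        ((2 * c - p) * geom p m + 2 * (geom p m - geom p (m - b)))) := by
  have hg : ∀ N, ∑ n ∈ Finset.range N, (p : ℚ) ^ (N - (n + 1)) = geom p N := fun N => by
    rw [geom, ← Finset.sum_range_reflect (fun n => (p : ℚ) ^ n)]
    exact Finset.sum_congr rfl fun n _ => by rw [Nat.sub_sub, add_comm]
  rw [fibonacciNumber_eq hp hh m l hm hl]
  congr 2
  · congr 1
    rw [show geom p (m + 1) - 2 * geom p (m + 1 - a) =
      2 * (geom p (m + 1) - geom p (m + 1 - a)) - geom p (m + 1) by ring,
      ← sum_ite_lt_mul_pow _ ha, ← hg, Finset.mul_sum, ← Finset.sum_sub_distrib]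
    refine Finset.sum_congr rfl fun n hn => ?_
    rw [Finset.mem_range] at hn
    rw [hα n (by omega), Nat.add_sub_add_right]
    push_cast
    ring
  · rw [← sum_ite_lt_mul_pow _ hb, ← hg, Finset.mul_sum, Finset.mul_sum,
      ← Finset.sum_add_distrib]
    refine Finset.sum_congr rfl fun n hn => ?_
    rw [Finset.mem_range] at hn
    rw [hβ n hn]
    push_cast
    ring

end PBratteli

/-! ### Evaluation on the intervals of the theorem. -/

theorem mainTheorem6 (p k r s l : ℕ) (hp : p.Prime) (hp2 : p ≠ 2)
    (hk : 2 ≤ k) (hr : r = k + s) (hs : 3 ≤ s) (hsk : s < k + 2) (hl : l < p ^ k) :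
    -- (a)
    (l = 0 →
      (fibonacciNumber p k r (evenVertex p k s l) : ℚ) =
        ((p : ℚ) - 1) / 2 * (2 * ((s : ℚ) - 1) * (p : ℚ) ^ (s - 1) + 1)) ∧
    -- (b)
    (∀ t : ℕ, 1 ≤ t → t ≤ (p - 3) / 2 →
      (∀ i : ℕ, i + 4 ≤ s →
        l ∈ Set.Ico ((t - 1) * powSum p i (k - 1) + p ^ i)
          ((t - 1) * powSum p (i + 1) (k - 1) + p ^ (i + 1)) →
        (fibonacciNumber p k r (evenVertex p k s l) : ℚ) =
          ((p : ℚ) - 1) / 2 * (2 * ((s : ℚ) - 1) * (p : ℚ) ^ (s - 1) + 1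
            + 2 * (t : ℚ) * powSum p 0 (s - 3) - 2 * powSum p 0 (s - i - 4))) ∧
      (l ∈ Set.Icc ((t - 1) * powSum p (s - 3) (k - 1) + p ^ (s - 3)) (t * powSum p 0 (k - 1)) →
        (fibonacciNumber p k r (evenVertex p k s l) : ℚ) =
          ((p : ℚ) - 1) / 2 * (2 * ((s : ℚ) - 1) * (p : ℚ) ^ (s - 1) + 1
            + 2 * (t : ℚ) * powSum p 0 (s - 3)))) ∧
    -- (c)
    (∀ i : ℕ, i + 4 ≤ s →
      l ∈ Set.Ico ((p - 3) / 2 * powSum p i (k - 1) + p ^ i)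
        ((p - 3) / 2 * powSum p (i + 1) (k - 1) + p ^ (i + 1)) →
      (fibonacciNumber p k r (evenVertex p k s l) : ℚ) =
        ((p : ℚ) - 1) / 2 * (2 * ((s : ℚ) - 1) * (p : ℚ) ^ (s - 1) + 1
          + ((p : ℚ) - 1) * powSum p 0 (s - 3) - 2 * powSum p 0 (s - i - 4))) ∧
    (l ∈ Set.Ico ((p - 3) / 2 * powSum p (s - 3) (k - 1) + p ^ (s - 3))
        ((p - 1) / 2 * powSum p (s - 2) (k - 1)) →
      (fibonacciNumber p k r (evenVertex p k s l) : ℚ) =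
        ((p : ℚ) - 1) / 2 * (2 * ((s : ℚ) - 1) * (p : ℚ) ^ (s - 1) + 1
          + (p : ℚ) ^ (s - 2) - 1)) ∧
    (∀ i : ℕ, 1 ≤ i → i ≤ s - 2 →
      l ∈ Set.Ico ((p - 1) / 2 * powSum p i (k - 1)) ((p - 1) / 2 * powSum p (i - 1) (k - 1)) →
      (fibonacciNumber p k r (evenVertex p k s l) : ℚ) =
        ((p : ℚ) - 1) / 2 * (2 * ((s : ℚ) - 1) * (p : ℚ) ^ (s - 1) - 1
          - (p : ℚ) ^ (s - 2) - 2 * powSum p 1 (s - 3)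
          + 2 * powSum p (s - i - 1) (s - 2) - 1)) ∧
    (l = (p - 1) / 2 * powSum p 0 (k - 1) →
      (fibonacciNumber p k r (evenVertex p k s l) : ℚ) =
        ((p : ℚ) - 1) / 2 * (2 * ((s : ℚ) - 1) * (p : ℚ) ^ (s - 1) - 1
          - (p : ℚ) ^ (s - 2) - 2 * powSum p 1 (s - 3) - 1)) ∧
    -- (d)
    (∀ t : ℕ, (p + 1) / 2 ≤ t → t ≤ p - 1 →
      (∀ i : ℕ, i + 4 ≤ s →
        l ∈ Set.Ico ((t - 1) * powSum p i (k - 1) + p ^ i)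
          ((t - 1) * powSum p (i + 1) (k - 1) + p ^ (i + 1)) →
        (fibonacciNumber p k r (evenVertex p k s l) : ℚ) =
          ((p : ℚ) - 1) / 2 * (2 * ((s : ℚ) - 1) * (p : ℚ) ^ (s - 1) - 1
            + (2 * (t : ℚ) - 2 * (p : ℚ)) * powSum p 0 (s - 3) - 2 * powSum p 0 (s - i - 4))) ∧
      (l ∈ Set.Icc ((t - 1) * powSum p (s - 3) (k - 1) + p ^ (s - 3)) (t * powSum p 0 (k - 1)) →
        (fibonacciNumber p k r (evenVertex p k s l) : ℚ) =
          ((p : ℚ) - 1) / 2 * (2 * ((s : ℚ) - 1) * (p : ℚ) ^ (s - 1) - 1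
            + (2 * (t : ℚ) - 2 * (p : ℚ)) * powSum p 0 (s - 3)))) := by
  obtain ⟨h, hph⟩ : ∃ h, p = 2 * h + 1 := hp.odd_of_ne_two hp2
  have hh : 1 ≤ h := by have := hp.two_le; omega
  obtain ⟨m, rfl⟩ : ∃ m, s = m + 2 := ⟨s - 2, by omega⟩
  subst hr
  have hm : m < k := by omega
  have hpq : (p : ℚ) = 2 * h + 1 := by rw [hph]; push_cast; ring
  have e1 : m + 2 - 1 = m + 1 := rfl
  have e2 : m + 2 - 2 = m := rfl
  have e3 : m + 2 - 3 = m - 1 := rfl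
  have e4 : (p - 1) / 2 = h := by omega
  have e5 : (p - 3) / 2 = h - 1 := by omega
  have e6 : ((p : ℚ) - 1) / 2 = h := by rw [hpq]; ring
  have e7 : ((m + 2 : ℕ) : ℚ) - 1 = m + 1 := by push_cast; ring
  have hg0 : geom p 0 = 0 := rfl
  have hg1 := geom_succ' p m
  have hg2 := geom_succ p m
  have hσ : ∀ N, 1 ≤ N → (powSum p 0 (N - 1) : ℚ) = geom p N := fun N hN => by
    rw [powSum_cast (Nat.zero_le _), Nat.sub_add_cancel hN, hg0, sub_zero]
  have hσm := hσ m (by omega)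
  have hσi : ∀ i, i + 4 ≤ m + 2 → (powSum p 0 (m + 2 - i - 4) : ℚ) = geom p (m - (i + 1)) :=
    fun i hi => by
      rw [← hσ _ (by omega)]
      congr 2
      omega
  have key := fun a b c => fibonacciNumber_eq_geom (a := a) (b := b) (c := c) hph hh hm hl
  -- Intervals on which `beta` is constant, equal to `c + 1`, for all `n < m`.
  have hlow : ∀ a c, a ≤ m + 1 → (∀ n ≤ m, alpha p h k n l = if n < a then 1 else 0) →
      c + 1 ≤ p → threshold p k c (m - 1) ≤ l → l ≤ (c + 1) * powSum p 0 (k - 1) →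
      (fibonacciNumber p k (k + (m + 2)) (evenVertex p k (m + 2) l) : ℚ) =
      h * (2 * (m + 1) * p ^ (m + 1) + (geom p (m + 1) - 2 * geom p (m + 1 - a)) +
        (2 * (c + 1 : ℕ) - p) * geom p m) := by
    intro a c ha hα hc h1 h2
    rw [key a 0 (c + 1) ha (Nat.zero_le _) hα fun n hn => by
      rw [beta_of_le hc (by omega) (by omega) h1 h2]; simp]
    rw [Nat.sub_zero, sub_self, mul_zero, add_zero]
  -- Intervals on which `beta` drops from `c + 1` to `c` after `n = i`.
  have hmid : ∀ a c i, a ≤ m + 1 → (∀ n ≤ m, alpha p h k n l = if n < a then 1 else 0) →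
      c + 1 ≤ p → i + 4 ≤ m + 2 → threshold p k c i ≤ l → l < threshold p k c (i + 1) →
      (fibonacciNumber p k (k + (m + 2)) (evenVertex p k (m + 2) l) : ℚ) =
      h * (2 * (m + 1) * p ^ (m + 1) + (geom p (m + 1) - 2 * geom p (m + 1 - a)) +
        ((2 * c - p) * geom p m + 2 * (geom p m - geom p (m - (i + 1))))) := by
    intro a c i ha hα hc hi h1 h2
    exact key a (i + 1) c ha (by omega) hα fun n hn =>
      beta_of_mem_Ico hc (by omega) (by omega) h1 h2
  have hall : l < h * powSum p m (k - 1) →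
      ∀ n ≤ m, alpha p h k n l = if n < m + 1 then 1 else 0 := fun h1 n hn => by
    rw [alpha_of_lt hn h1, if_pos (by omega)]
  have hnone : h * powSum p 0 (k - 1) ≤ l → ∀ n ≤ m, alpha p h k n l = if n < 0 then 1 else 0 :=
    fun h1 n hn => by rw [alpha_of_ge (Nat.zero_le n) h1, if_neg (by omega)]
  have hpred := pred_mul_powSum_lt hph hh hm
  have hthr : threshold p k (h - 1) (m - 1) ≤ h * powSum p m (k - 1) := by
    have := threshold_le_mul_powSum (k := k) (m := m - 1) hph hh (by omega)
    rwa [Nat.sub_add_cancel (by omega)] at this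
  have hanti : ∀ a b, a ≤ b → h * powSum p b (k - 1) ≤ h * powSum p a (k - 1) :=
    fun a b hab => Nat.mul_le_mul_left _ (powSum_antitone hab)
  have hh1 : h - 1 + 1 = h := Nat.sub_add_cancel hh
  rw [e1, e2, e3, e4, e5, e6, e7]
  have hnat : ∀ c i : ℕ, c * powSum p i (k - 1) + p ^ i = threshold p k c i := fun _ _ => rfl
  simp only [hnat, Set.mem_Ico, Set.mem_Icc]
  refine ⟨?_, ?_, ?_, ?_, ?_, ?_, ?_⟩
  · rintro rfl
    rw [key (m + 1) 0 0 le_rfl (Nat.zero_le _) (hall (by omega)) fun n _ =>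
      beta_zero_right (by omega), Nat.sub_self, hg0, hg1, Nat.sub_zero]
    push_cast
    ring
  · intro t ht ht'
    obtain ⟨c, rfl⟩ : ∃ c, t = c + 1 := ⟨t - 1, by omega⟩
    rw [Nat.add_sub_cancel]
    have h3 : (c + 1) * powSum p 0 (k - 1) ≤ (h - 1) * powSum p 0 (k - 1) :=
      Nat.mul_le_mul_right _ ht'
    constructor
    · rintro i hi ⟨h1, h2⟩
      have h4 := threshold_le_threshold_succ (p := p) (x := c) (show i + 1 < k by omega)
      rw [threshold_zero] at h4
      rw [hmid (m + 1) c i le_rfl (hall (by omega)) (by omega) hi h1 h2, Nat.sub_self, hg0, hg1,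
        hσm, hσi i hi]
      push_cast
      ring
    · rintro ⟨h1, h2⟩
      rw [hlow (m + 1) c le_rfl (hall (by omega)) (by omega) h1 h2, Nat.sub_self, hg0, hg1, hσm]
      push_cast
      ring
  · rintro i hi ⟨h1, h2⟩
    have h4 := threshold_mono_right (p := p) (k := k) (x := h - 1) (n := i + 1) (n' := m - 1)
      (by omega) (by omega) (by omega)
    rw [hmid (m + 1) (h - 1) i le_rfl (hall (by omega)) (by omega) hi h1 h2, Nat.sub_self, hg0,
      hg1, hσm, hσi i hi, Nat.cast_sub hh, hpq]
    push_cast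
    ring
  · rintro ⟨h1, h2⟩
    have := hanti 0 m (Nat.zero_le _)
    rw [hlow (m + 1) (h - 1) le_rfl (hall h2) (by omega) h1 (by rw [hh1]; omega), Nat.sub_self,
      hg0, hh1]
    rw [hg1] at hg2 ⊢
    rw [hpq] at hg2 ⊢
    linear_combination h * hg2
  · rintro i hi hi' ⟨h1, h2⟩
    have h3 := hanti i m hi'
    have h4 := hanti 0 (i - 1) (Nat.zero_le _)
    -- Here `beta` stays equal to `h`, while `alpha` is one exactly for `n < i`.
    rw [hlow i (h - 1) (by omega) ?_ (by omega) (by omega) (by rw [hh1]; omega), hh1,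
      powSum_cast (show 1 ≤ m - 1 + 1 by omega), powSum_cast (show m + 2 - i - 1 ≤ m + 1 by omega),
      show m + 2 - i - 1 = m + 1 - i by omega, Nat.sub_add_cancel (by omega),
      show geom p 1 = 1 by simp [geom]]
    · rw [hpq] at hg2 ⊢
      linear_combination -h * hg2
    · intro n hn
      split_ifs with h5
      · exact alpha_of_lt (m := i - 1) (by omega) h2
      · exact alpha_of_ge (m := i) (by omega) h1
  · intro h1
    have := hanti 0 m (Nat.zero_le _)
    rw [hlow 0 (h - 1) (Nat.zero_le _) (hnone h1.ge) (by omega) (by omega) (by rw [hh1, h1]), hh1,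
      powSum_cast (show 1 ≤ m - 1 + 1 by omega), Nat.sub_add_cancel (by omega),
      show geom p 1 = 1 by simp [geom], Nat.sub_zero]
    rw [hpq] at hg2 ⊢
    linear_combination -h * hg2
  · intro t ht ht'
    obtain ⟨c, rfl⟩ : ∃ c, t = c + 1 := ⟨t - 1, by omega⟩
    rw [Nat.add_sub_cancel]
    -- As `t ≥ h + 1` gives `c ≥ h`, `l` exceeds `h * powSum p 0 (k - 1)` and every `alpha`
    -- vanishes.
    have h3 : ∀ i ≤ k, threshold p k h 0 ≤ threshold p k c i := fun i hi =>
      (threshold_mono_left (by omega)).trans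
        (threshold_mono_right (by omega) (Nat.zero_le _) hi)
    rw [threshold_zero] at h3
    constructor
    · rintro i hi ⟨h1, h2⟩
      have h4 := h3 i (by omega)
      rw [hmid 0 c i (Nat.zero_le _) (hnone (by omega)) (by omega) hi h1 h2, Nat.sub_zero, hg1,
        hσm, hσi i hi]
      push_cast
      ring
    · rintro ⟨h1, h2⟩
      have h4 := h3 (m - 1) (by omega)
      rw [hlow 0 c (Nat.zero_le _) (hnone (by omega)) (by omega) h1 h2, Nat.sub_zero, hg1, hσm]
      push_cast
      ring
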